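/- Let $\mathcal S,\mathcal X,\mathcal Y,\mathcal Z$ be finite sets with $\mathcal S,\mathcal X$ nonempty, and let $W_{YZ|XS}$ be a channel from $\mathcal X\times\mathcal S$ to $\mathcal Y\times\mathcal Z$, with marginals $W_{Y|X,s}$ and $W_{Z|X,s}$ for $s\in\mathcal S$. The channel is used memorylessly, with a state $s$ that is unknown and fixed during the whole transmission. An open-loop code of length $n$ consists of a number of messages $M\ge 1$, an encoder $f:\{1,\dots,M\}\to\mathcal X^n$, a state estimator $g:\mathcal X^n\times\mathcal Z^n\to\mathcal S$ and a decoder $h:\mathcal Y^n\to\{1,\dots,M\}$. Its communication-error and detection-error probabilities are $$P_c=\max_{s}\max_{w}\mathbb P\big(h(Y^n)\ne w\mid X^n=f(w),S=s\big),\qquad P_d=\max_{s}\max_{w}\mathbb P\big(g(X^n,Z^n)\ne s\mid X^n=f(w),S=s\big).$$ A pair $(R,E)\in\mathbb R_+^2$ is achievable if for every $\epsilon>0$ there are arbitrarily large $n$ for which there is an open-loop code of length $n$ with $P_c\le\epsilon$, $-\frac1n\log P_d\ge E-\epsilon$ and $\frac1n\log M\ge R-\epsilon$. Let $\mathbf C_{\mathrm{open}}^{(m)}$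 be the closure of the set of achievable pairs. Logarithms are natural and $-\log 0=+\infty$. For a probability distribution $P_X$ on $\mathcal X$ let $\mathbb I(P_X,W_{Y|X,s})$ be the mutual information between the input and the output of $W_{Y|X,s}$ when the input has distribution $P_X$, and let $$\phi(P_X)=\min_{s\in\mathcal S}\ \min_{s'\ne s}\ \sup_{\ell\in[0,1]}\ -\sum_{x}P_X(x)\log\Big(\sum_z W_{Z|X,s}(z|x)^{\ell}\,W_{Z|X,s'}(z|x)^{1-\ell}\Big)\in[0,+\infty],$$ where $0\cdot(+\infty)=0$, $0^0=1$, and the minimum over the empty set (when $|\mathcal S|=1$) is $+\infty$. Suppose that there is $x_0\in\mathcal X$ such that for every $x\in\mathcal X$ there is a permutation $\pi_x$ of $\mathcal Z$ with $$W_{Z|X,s}(z|x)=W_{Z|X,s}(\pi_x(z)|x_0)\qquad\text{for all } s\in\mathcal S,\ z\in\mathcal Z.$$ Then $\phi(P_X)$ does not depend on $P_X$, the two maxima below are attained, and $$\mathbf C_{\mathrm{open}}^{(m)}=\Big\{(R,E)\in\mathbb R_+^2:\ R\le\max_{P_X}\min_{s\in\mathcal S}\mathbb I(P_X,W_{Y|X,s}),\quad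 E\le\max_{P_X}\phi(P_X)\Big\}.$$ -/

import Mathlib

open scoped BigOperators

noncomputable section

namespace JointCommSensing

variable {S X Y Z : Type*} [Fintype X] [Fintype Y] [Fintype Z]

/-- The marginal communication channel `W_{Y|X,s}(y|x)` of the state-dependent memoryless channel
`W_{YZ|XS}`, given as `W s x = W_{YZ|XS}(·|x,s)`. -/
def chanY (W : S → X → stdSimplex ℝ (Y × Z)) (s : S) (x : X) (y : Y) : ℝ :=
  ∑ z, W s x (y, z)

/-- The marginal sensing channel `W_{Z|X,s}(z|x)`. -/
def chanZ (W : S → X → stdSimplex ℝ (Y × Z)) (s : S) (x : X) (z : Z) : ℝ :=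
  ∑ y, W s x (y, z)

/-- Shannon entropy in nats; `Real.negMulLog t = -t log t`. -/
def entropy {A : Type*} [Fintype A] (p : A → ℝ) : ℝ :=
  ∑ a, Real.negMulLog (p a)

/-- Mutual information `I(P, V) = H(P ∘ V) - H(V | P)`. -/
def mutualInfo (P : stdSimplex ℝ X) (V : X → Y → ℝ) : ℝ :=
  entropy (fun y => ∑ x, P x * V x y) - ∑ x, P x * entropy (V x)

/-- `min_s I(P, W_{Y|X,s})`. -/
def compoundInfo [Fintype S] [Nonempty S] (W : S → X → stdSimplex ℝ (Y × Z))
    (P : stdSimplex ℝ X) : ℝ :=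
  Finset.univ.inf' Finset.univ_nonempty fun s => mutualInfo P (chanY W s)

/-- `-log t` for `t ≥ 0`, with `-log 0 = +∞`. -/
def negLog (t : ℝ) : EReal :=
  -ENNReal.log (ENNReal.ofReal t)

/-- `φ(P) = min_s min_{s' ≠ s} sup_{ℓ ∈ [0,1]} - ∑_x P(x) log ∑_z W_s(z|x)^ℓ W_{s'}(z|x)^{1-ℓ}`,
with values in `[0, +∞]`; here `0 · (+∞) = 0`, and the minimum over an empty set is `+∞`. -/
def phi (W : S → X → stdSimplex ℝ (Y × Z)) (P : stdSimplex ℝ X) : EReal :=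
  ⨅ (s : S) (s' : S) (_ : s' ≠ s), ⨆ ℓ ∈ Set.Icc (0 : ℝ) 1,
    ∑ x, (P x : EReal) * negLog (∑ z, chanZ W s x z ^ ℓ * chanZ W s' x z ^ (1 - ℓ))

/-- An open-loop code of length `n`: the encoder does not use the observations `Z^{i-1}`. -/
structure OpenLoopCode (S X Y Z : Type*) (n : ℕ) where
  /-- The number of messages. -/
  M : ℕ
  M_pos : 0 < M
  /-- The encoder, mapping a message to its codeword. -/
  enc : Fin M → Fin n → X
  /-- The state estimator at the transmitter, which knows the codeword. -/
  est : (Fin n → X) → (Fin n → Z) → S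
  /-- The message decoder at the receiver. -/
  dec : (Fin n → Y) → Fin M

/-- Probability that the outputs `(Y_i, Z_i)_i` lie in `A`, when the codeword `x` is sent over the
memoryless channel whose state is `s` during the whole transmission. -/
def outProb {n : ℕ} (W : S → X → stdSimplex ℝ (Y × Z)) (s : S) (x : Fin n → X)
    (A : Set (Fin n → Y × Z)) : ℝ :=
  ∑ o : Fin n → Y × Z, A.indicator (fun o => ∏ i, W s (x i) (o i)) o

namespace OpenLoopCode

variable {n : ℕ}

/-- `P_c = max_s max_w ℙ(h(Y^n) ≠ w | W = w, S = s)`. The index set is finite and, when `S` is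
nonempty, nonempty. -/
def commError (C : OpenLoopCode S X Y Z n) (W : S → X → stdSimplex ℝ (Y × Z)) : ℝ :=
  ⨆ p : S × Fin C.M, outProb W p.1 (C.enc p.2) {o | C.dec (fun i => (o i).1) ≠ p.2}

/-- `P_d = max_s max_w ℙ(g(X^n, Z^n) ≠ s | W = w, S = s)`. -/
def detError (C : OpenLoopCode S X Y Z n) (W : S → X → stdSimplex ℝ (Y × Z)) : ℝ :=
  ⨆ p : S × Fin C.M,
    outProb W p.1 (C.enc p.2) {o | C.est (C.enc p.2) (fun i => (o i).2) ≠ p.1}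

/-- `R^{(n)} = (1/n) log M`. -/
def rate (C : OpenLoopCode S X Y Z n) : ℝ :=
  1 / (n : ℝ) * Real.log C.M

/-- `E_d^{(n)} = -(1/n) log P_d`, which is `+∞` when `P_d = 0`. -/
def detExponent (C : OpenLoopCode S X Y Z n) (W : S → X → stdSimplex ℝ (Y × Z)) : EReal :=
  ((1 / (n : ℝ) : ℝ) : EReal) * negLog (C.detError W)

end OpenLoopCode

/-- The pair `(R, E)` is achieved, up to every `ε > 0`, by open-loop codes of arbitrarily large
block length. -/
def Achievable (W : S → X → stdSimplex ℝ (Y × Z)) (R E : ℝ) : Prop :=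
  ∀ ε : ℝ, 0 < ε → ∀ N : ℕ, ∃ n : ℕ, N < n ∧ ∃ C : OpenLoopCode S X Y Z n,
    C.commError W ≤ ε ∧ ((E - ε : ℝ) : EReal) ≤ C.detExponent W ∧ R - ε ≤ C.rate

/-- The open-loop region: closure of the set of achievable pairs of nonnegative reals. -/
def openLoopRegion (W : S → X → stdSimplex ℝ (Y × Z)) : Set (ℝ × ℝ) :=
  closure {p | 0 ≤ p.1 ∧ 0 ≤ p.2 ∧ Achievable W p.1 p.2}

end JointCommSensing

end

/-! The permutation in the symmetry hypothesis is the same for all states. Hence, for any codeword,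
the family of laws of `Z^n` indexed by the state is, up to a relabelling of the outputs, the one
produced by the constant codeword `x₀`. Sensing is thus indifferent to the code: `phi` is constant,
no trade-off arises, and the region is the rectangle cut out by two separate problems.

Detection is hypothesis testing between the product laws of row `x₀`. Maximum likelihood attains the
exponent by Chernoff's bound (`SensingSymmetric.exists_estimator`). Conversely any estimator pays
half the overlap of two such laws (`SensingSymmetric.sum_min_le_detError`), and `chernoff_overlap`
bounds the overlap from below by a change of measure to the tilted law at the minimising `l`.

Communication is coding for a finite compound channel. Achievability (`compound_code`) applies
Feinstein's lemma to the uniform mixture of the `n`-fold channels; its error dominates that of each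
state up to the factor `card S`. The weak converse (`log_card_le_mutualInfo`) compares the output
laws with the product law generated by the average type of the code, an input distribution that does
not depend on the state.

The achievable set so obtained is already closed, so the closure adds nothing. -/

noncomputable section

namespace JointCommSensing

/-! ### Moments and the weak law of large numbers for finite product distributions. -/

section ProductSums

variable {A : Type*} [Fintype A]

theorem sum_fin_succ_fun {n : ℕ} (F : (Fin (n + 1) → A) → ℝ) :
    ∑ o, F o = ∑ a, ∑ o : Fin n → A, F (Fin.cons a o) := by
  rw [← Fintype.sum_prod_type']
  exact (Fintype.sum_equiv (Fin.consEquiv fun _ => A) _ _ fun _ => rfl).symm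

theorem sum_prod_fun {n : ℕ} (p : Fin n → A → ℝ) :
    ∑ o : Fin n → A, ∏ i, p i (o i) = ∏ i, ∑ a, p i a := by
  classical
  rw [Finset.prod_univ_sum, Fintype.piFinset_univ]

theorem sum_prod_eq_one {n : ℕ} {p : Fin n → A → ℝ} (h : ∀ i, ∑ a, p i a = 1) :
    ∑ o : Fin n → A, ∏ i, p i (o i) = 1 := by
  rw [sum_prod_fun]; simp [h]

/-- The expectation of a sum of functions of the coordinates under a product distribution. -/
theorem sum_prod_mul_sum {n : ℕ} {p : Fin n → A → ℝ} (h : ∀ i, ∑ a, p i a = 1)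
    (g : Fin n → A → ℝ) :
    ∑ o : Fin n → A, (∏ i, p i (o i)) * ∑ i, g i (o i) = ∑ i, ∑ a, p i a * g i a := by
  induction n with
  | zero => simp
  | succ n ih =>
    rw [sum_fin_succ_fun, Fin.sum_univ_succ]
    simp only [Fin.prod_univ_succ, Fin.sum_univ_succ, Fin.cons_zero, Fin.cons_succ]
    have h1 := sum_prod_eq_one (p := fun i => p i.succ) fun i => h i.succ
    have h2 := ih (p := fun i => p i.succ) (fun i => h i.succ) fun i => g i.succ
    have h3 : ∀ a, ∑ o : Fin n → A, p 0 a * (∏ i, p (Fin.succ i) (o i)) *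
        (g 0 a + ∑ i, g (Fin.succ i) (o i)) =
        p 0 a * g 0 a + p 0 a * ∑ i, ∑ a, p (Fin.succ i) a * g (Fin.succ i) a := by
      intro a
      rw [← h2]
      have : p 0 a * g 0 a = p 0 a * g 0 a * ∑ o : Fin n → A, ∏ i, p (Fin.succ i) (o i) := by
        rw [h1, mul_one]
      rw [this, Finset.mul_sum, Finset.mul_sum, ← Finset.sum_add_distrib]
      exact Finset.sum_congr rfl fun o _ => by ring
    simp only [h3, Finset.sum_add_distrib, ← Finset.sum_mul, h 0, one_mul]

/-- The variance of a sum of centred functions of the coordinates under a product distribution. -/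
theorem sum_prod_mul_sum_sq {n : ℕ} {p : Fin n → A → ℝ} (h : ∀ i, ∑ a, p i a = 1)
    {g : Fin n → A → ℝ} (hg : ∀ i, ∑ a, p i a * g i a = 0) :
    ∑ o : Fin n → A, (∏ i, p i (o i)) * (∑ i, g i (o i)) ^ 2 =
      ∑ i, ∑ a, p i a * g i a ^ 2 := by
  induction n with
  | zero => simp
  | succ n ih =>
    rw [sum_fin_succ_fun, Fin.sum_univ_succ]
    simp only [Fin.prod_univ_succ, Fin.sum_univ_succ, Fin.cons_zero, Fin.cons_succ]
    have h1 := sum_prod_eq_one (p := fun i => p i.succ) fun i => h i.succ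
    have h2 := ih (p := fun i => p i.succ) (fun i => h i.succ) (g := fun i => g i.succ)
      fun i => hg i.succ
    have h4 := sum_prod_mul_sum (p := fun i => p i.succ) (fun i => h i.succ) fun i => g i.succ
    simp only [hg, Finset.sum_const_zero] at h4
    have h3 : ∀ a, ∑ o : Fin n → A, p 0 a * (∏ i, p (Fin.succ i) (o i)) *
        (g 0 a + ∑ i, g (Fin.succ i) (o i)) ^ 2 =
        p 0 a * g 0 a ^ 2 + p 0 a * ∑ i, ∑ a, p (Fin.succ i) a * g (Fin.succ i) a ^ 2 := by
      intro a
      rw [← h2]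
      -- The last summand is zero: it is the cross term of the square, whose mean vanishes by `h4`.
      have : p 0 a * g 0 a ^ 2 = p 0 a * g 0 a ^ 2 *
          (∑ o : Fin n → A, ∏ i, p (Fin.succ i) (o i)) + 2 * p 0 a * g 0 a *
          ∑ o : Fin n → A, (∏ i, p (Fin.succ i) (o i)) * ∑ i, g (Fin.succ i) (o i) := by
        rw [h1, h4, mul_one, mul_zero, add_zero]
      rw [this, Finset.mul_sum, Finset.mul_sum, Finset.mul_sum, ← Finset.sum_add_distrib,
        ← Finset.sum_add_distrib]
      exact Finset.sum_congr rfl fun o _ => by ring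
    simp only [h3, Finset.sum_add_distrib, ← Finset.sum_mul, h 0, one_mul]

/-- Chebyshev's inequality for sums over a product distribution. -/
theorem chebyshev_prod {n : ℕ} {p : A → ℝ} (hp : ∀ a, 0 ≤ p a) (h : ∑ a, p a = 1)
    (g : A → ℝ) {t : ℝ} (ht : 0 < t) :
    ∑ o : Fin n → A with t ≤ |∑ i, g (o i) - n * ∑ a, p a * g a|, ∏ i, p (o i) ≤
      n * (∑ a, p a * (g a - ∑ b, p b * g b) ^ 2) / t ^ 2 := by
  set m := ∑ a, p a * g a with hm
  have key := sum_prod_mul_sum_sq (n := n) (p := fun _ => p) (fun _ => h)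
    (g := fun _ a => g a - m) (fun _ => by
      simp only [mul_sub, Finset.sum_sub_distrib, ← Finset.sum_mul, h, one_mul]; rw [← hm, sub_self])
  simp only [Finset.sum_const, Finset.card_univ, Fintype.card_fin, nsmul_eq_mul,
    Finset.sum_sub_distrib] at key
  rw [← key, le_div_iff₀ (by positivity), Finset.sum_mul]
  refine (Finset.sum_le_sum fun o ho => ?_).trans
    (Finset.sum_le_sum_of_subset_of_nonneg (Finset.filter_subset _ _) fun o _ _ =>
      mul_nonneg (Finset.prod_nonneg fun _ _ => hp _) (sq_nonneg _))
  have ho := (Finset.mem_filter.1 ho).2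
  refine mul_le_mul_of_nonneg_left ?_ (Finset.prod_nonneg fun _ _ => hp _)
  rw [← sq_abs (∑ i, g (o i) - _)]
  exact pow_le_pow_left₀ ht.le ho 2

/-- The lower tail of the weak law of large numbers, for finite alphabets. -/
theorem weak_law_lower {p : A → ℝ} (hp : ∀ a, 0 ≤ p a) (h : ∑ a, p a = 1)
    (g : A → ℝ) {δ ε : ℝ} (hδ : 0 < δ) (hε : 0 < ε) :
    ∃ N : ℕ, ∀ n : ℕ, N ≤ n →
      ∑ o : Fin n → A with ∑ i, g (o i) ≤ n * (∑ a, p a * g a - δ), ∏ i, p (o i) ≤ ε := by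
  set v := ∑ a, p a * (g a - ∑ b, p b * g b) ^ 2 with hv
  obtain ⟨N, hN⟩ := exists_nat_gt (v / (δ ^ 2 * ε))
  refine ⟨N + 1, fun n hn => ?_⟩
  have hn0 : (0 : ℝ) < n := by exact_mod_cast (Nat.succ_pos N).trans_le hn
  have hNn : (N : ℝ) ≤ n := by exact_mod_cast (Nat.le_succ N).trans hn
  refine le_trans ?_ ((chebyshev_prod (n := n) hp h g (mul_pos hn0 hδ)).trans ?_)
  · refine Finset.sum_le_sum_of_subset_of_nonneg (fun o ho => ?_) fun o _ _ =>
      Finset.prod_nonneg fun _ _ => hp _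
    have ho := (Finset.mem_filter.1 ho).2
    refine Finset.mem_filter.2 ⟨Finset.mem_univ _, ?_⟩
    rw [abs_sub_comm]
    refine le_trans ?_ (le_abs_self _)
    linarith
  · rw [← hv, div_le_iff₀ (by positivity)]
    have := (div_lt_iff₀ (by positivity)).1 (hN.trans_le hNn)
    nlinarith

/-- The upper tail of the weak law of large numbers, for finite alphabets. -/
theorem weak_law_upper {p : A → ℝ} (hp : ∀ a, 0 ≤ p a) (h : ∑ a, p a = 1)
    (g : A → ℝ) {δ ε : ℝ} (hδ : 0 < δ) (hε : 0 < ε) :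
    ∃ N : ℕ, ∀ n : ℕ, N ≤ n →
      ∑ o : Fin n → A with n * (∑ a, p a * g a + δ) ≤ ∑ i, g (o i), ∏ i, p (o i) ≤ ε := by
  obtain ⟨N, hN⟩ := weak_law_lower hp h (fun a => -g a) hδ hε
  refine ⟨N, fun n hn => le_of_eq_of_le ?_ (hN n hn)⟩
  refine Finset.sum_congr (Finset.filter_congr fun o _ => ?_) fun _ _ => rfl
  simp only [mul_neg, Finset.sum_neg_distrib]
  constructor <;> intro h <;> linarith

end ProductSums

/-! ### Lower bound on the overlap of two product laws. -/

section Chernoff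

variable {A : Type*} [Fintype A]

/-- A distribution whose relative entropies to `P` and to `Q` are at most `C` witnesses that the
overlap of the `n`-fold products of `P` and `Q` is at least `exp (-n (C + δ)) / 2`. -/
theorem overlap_of_witness {P Q V : A → ℝ} (hP : ∀ a, 0 ≤ P a) (hQ : ∀ a, 0 ≤ Q a)
    (hV : ∀ a, 0 ≤ V a) (hV1 : ∑ a, V a = 1) (hVP : ∀ a, 0 < V a → 0 < P a)
    (hVQ : ∀ a, 0 < V a → 0 < Q a) {C : ℝ}
    (hP' : ∑ a, V a * (Real.log (V a) - Real.log (P a)) ≤ C)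
    (hQ' : ∑ a, V a * (Real.log (V a) - Real.log (Q a)) ≤ C) {δ : ℝ} (hδ : 0 < δ) :
    ∃ N : ℕ, ∀ n : ℕ, N ≤ n →
      Real.exp (-(n * (C + δ))) / 2 ≤ ∑ o : Fin n → A, min (∏ i, P (o i)) (∏ i, Q (o i)) := by
  classical
  -- Two exceptional sets of `V`-mass at most 1/4 leave mass at least 1/2, the source of the factor
  -- 1/2 in the bound.
  obtain ⟨N₁, hN₁⟩ := weak_law_upper hV hV1 (fun a => Real.log (V a) - Real.log (P a)) hδ
    (ε := 1 / 4) (by norm_num)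
  obtain ⟨N₂, hN₂⟩ := weak_law_upper hV hV1 (fun a => Real.log (V a) - Real.log (Q a)) hδ
    (ε := 1 / 4) (by norm_num)
  refine ⟨max N₁ N₂, fun n hn => ?_⟩
  have h1 := hN₁ n ((le_max_left _ _).trans hn)
  have h2 := hN₂ n ((le_max_right _ _).trans hn)
  have h3 := sum_prod_eq_one (n := n) (p := fun _ => V) fun _ => hV1
  rw [Finset.sum_filter] at h1 h2
  have step : ∀ (R : A → ℝ), (∀ a, 0 < V a → 0 < R a) →
      ∑ a, V a * (Real.log (V a) - Real.log (R a)) ≤ C → ∀ o : Fin n → A,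
      (∀ i, 0 < V (o i)) →
      ¬ n * (∑ a, V a * (Real.log (V a) - Real.log (R a)) + δ) ≤
        ∑ i, (Real.log (V (o i)) - Real.log (R (o i))) →
      Real.exp (-(n * (C + δ))) * ∏ i, V (o i) ≤ ∏ i, R (o i) := by
    intro R hR hC o ho hlt
    have hVe : ∏ i, V (o i) = Real.exp (∑ i, Real.log (V (o i))) := by
      rw [Real.exp_sum]; exact Finset.prod_congr rfl fun i _ => (Real.exp_log (ho i)).symm
    have hRe : ∏ i, R (o i) = Real.exp (∑ i, Real.log (R (o i))) := by
      rw [Real.exp_sum]; exact Finset.prod_congr rfl fun i _ => (Real.exp_log (hR _ (ho i))).symm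
    rw [hVe, hRe, ← Real.exp_add]
    refine Real.exp_le_exp.2 ?_
    rw [Finset.sum_sub_distrib] at hlt
    have : (n : ℝ) * (∑ a, V a * (Real.log (V a) - Real.log (R a)) + δ) ≤ n * (C + δ) := by
      gcongr
    linarith [not_le.1 hlt]
  -- The bracket is nonpositive on either exceptional set, so this pointwise bound sums directly
  -- without handling the good set explicitly.
  have key : ∀ o : Fin n → A, Real.exp (-(n * (C + δ))) * (∏ i, V (o i) -
      (if n * (∑ a, V a * (Real.log (V a) - Real.log (P a)) + δ) ≤
        ∑ i, (Real.log (V (o i)) - Real.log (P (o i))) then ∏ i, V (o i) else 0) -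
      (if n * (∑ a, V a * (Real.log (V a) - Real.log (Q a)) + δ) ≤
        ∑ i, (Real.log (V (o i)) - Real.log (Q (o i))) then ∏ i, V (o i) else 0)) ≤
      min (∏ i, P (o i)) (∏ i, Q (o i)) := by
    intro o
    have hVn : 0 ≤ ∏ i, V (o i) := Finset.prod_nonneg fun _ _ => hV _
    have hmin : 0 ≤ min (∏ i, P (o i)) (∏ i, Q (o i)) :=
      le_min (Finset.prod_nonneg fun _ _ => hP _) (Finset.prod_nonneg fun _ _ => hQ _)
    have hneg : ∀ t : ℝ, t ≤ 0 → Real.exp (-(n * (C + δ))) * t ≤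
        min (∏ i, P (o i)) (∏ i, Q (o i)) := fun t ht =>
      (mul_nonpos_of_nonneg_of_nonpos (Real.exp_pos _).le ht).trans hmin
    by_cases ho : ∀ i, 0 < V (o i)
    · split_ifs with ha hb hb
      · exact hneg _ (by linarith)
      · exact hneg _ (by linarith)
      · exact hneg _ (by linarith)
      · rw [sub_zero, sub_zero]
        exact le_min (step P hVP hP' o ho ha) (step Q hVQ hQ' o ho hb)
    · push Not at ho
      obtain ⟨i, hi⟩ := ho
      have : ∏ i, V (o i) = 0 :=
        Finset.prod_eq_zero (Finset.mem_univ i) (le_antisymm hi (hV _))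
      exact hneg _ (by simp [this])
  refine le_trans ?_ (Finset.sum_le_sum fun o _ => key o)
  rw [← Finset.mul_sum, Finset.sum_sub_distrib, Finset.sum_sub_distrib, h3, div_eq_mul_inv]
  refine mul_le_mul_of_nonneg_left ?_ (Real.exp_pos _).le
  linarith

/-- If the Chernoff coefficients of `P` and `Q` are at least `exp (-C)`, some distribution has
relative entropy at most `C` to both. -/
theorem exists_tilted {P Q : A → ℝ} (hP : ∀ a, 0 ≤ P a) (hQ : ∀ a, 0 ≤ Q a) {C : ℝ}
    (hC : ∀ l ∈ Set.Ioo (0 : ℝ) 1, Real.exp (-C) ≤ ∑ a, P a ^ l * Q a ^ (1 - l)) :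
    ∃ V : A → ℝ, (∀ a, 0 ≤ V a) ∧ ∑ a, V a = 1 ∧ (∀ a, 0 < V a → 0 < P a) ∧
      (∀ a, 0 < V a → 0 < Q a) ∧ ∑ a, V a * (Real.log (V a) - Real.log (P a)) ≤ C ∧
      ∑ a, V a * (Real.log (V a) - Real.log (Q a)) ≤ C := by
  classical
  -- On the common support the Chernoff sum is the smooth function `g`. They agree for `l` in the
  -- open interval; at the endpoints `0 ^ 0 = 1` can make the Chernoff sum larger, so the bound on
  -- `g` there comes from continuity.
  set T : Finset A := Finset.univ.filter fun a => 0 < P a ∧ 0 < Q a with hT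
  have hTP : ∀ a ∈ T, 0 < P a := fun a ha => (Finset.mem_filter.1 ha).2.1
  have hTQ : ∀ a ∈ T, 0 < Q a := fun a ha => (Finset.mem_filter.1 ha).2.2
  set r : A → ℝ := fun a => Real.log (P a) - Real.log (Q a) with hr
  set g : ℝ → ℝ := fun l => ∑ a ∈ T, Real.exp (Real.log (Q a) + l * r a) with hg
  have hgd : ∀ l, HasDerivAt g (∑ a ∈ T, Real.exp (Real.log (Q a) + l * r a) * r a) l := by
    intro l
    refine HasDerivAt.fun_sum fun a _ => HasDerivAt.exp ?_
    simpa using ((hasDerivAt_id l).mul_const (r a)).const_add (Real.log (Q a))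
  have hgc : Continuous g := continuous_iff_continuousAt.2 fun l => (hgd l).continuousAt
  have hgIoo : ∀ l ∈ Set.Ioo (0 : ℝ) 1, Real.exp (-C) ≤ g l := by
    intro l hl
    refine (hC l hl).trans (le_of_eq ?_)
    rw [← Finset.sum_subset (Finset.subset_univ T)]
    · refine Finset.sum_congr rfl fun a ha => ?_
      rw [Real.rpow_def_of_pos (hTP a ha), Real.rpow_def_of_pos (hTQ a ha), ← Real.exp_add]
      congr 1
      simp only [hr]; ring
    · intro a _ ha
      have h0 : P a = 0 ∨ Q a = 0 := by
        by_contra hcon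
        push Not at hcon
        exact ha (Finset.mem_filter.2 ⟨Finset.mem_univ _, lt_of_le_of_ne (hP a) hcon.1.symm,
          lt_of_le_of_ne (hQ a) hcon.2.symm⟩)
      rcases h0 with h0 | h0
      · rw [h0, Real.zero_rpow hl.1.ne', zero_mul]
      · rw [h0, Real.zero_rpow (sub_pos.2 hl.2).ne', mul_zero]
  have hgIcc : ∀ l ∈ Set.Icc (0 : ℝ) 1, Real.exp (-C) ≤ g l := by
    intro l hl
    rw [← closure_Ioo zero_ne_one] at hl
    exact closure_minimal (t := {l | Real.exp (-C) ≤ g l}) hgIoo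
      (isClosed_le continuous_const hgc) hl
  obtain ⟨l, hl, hmin⟩ := isCompact_Icc.exists_isMinOn (Set.nonempty_Icc.2 zero_le_one)
    hgc.continuousOn
  set g' := ∑ a ∈ T, Real.exp (Real.log (Q a) + l * r a) * r a with hg'
  have hgpos : 0 < g l := (Real.exp_pos _).trans_le (hgIcc l hl)
  -- First-order condition at the minimiser. The directions `y = 0` and `y = 1` give `l * g' ≤ 0`
  -- and `(l - 1) * g' ≤ 0`, covering interior and endpoint minima at once. With `V` the law tilted
  -- at `l`, the two divergences are `(l - 1) * g' / g l` and `l * g' / g l`, each minus `log (g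
  -- l)`.
  have hdir : ∀ y ∈ Set.Icc (0 : ℝ) 1, 0 ≤ g' * (y - l) := by
    intro y hy
    have := (hmin.localize).hasFDerivWithinAt_nonneg (hgd l).hasFDerivAt.hasFDerivWithinAt
      (sub_mem_posTangentConeAt_of_segment_subset ((convex_Icc (0 : ℝ) 1).segment_subset hl hy))
    rw [hg']
    simpa [mul_comm] using this
  have h0 := hdir 0 (by simp)
  have h1 := hdir 1 (by simp)
  have hlog : -Real.log (g l) ≤ C := by
    have := (Real.le_log_iff_exp_le hgpos).2 (hgIcc l hl)
    linarith
  set V : A → ℝ := fun a => if a ∈ T then Real.exp (Real.log (Q a) + l * r a) / g l else 0 with hVdef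
  have hVT : ∀ a, 0 < V a → a ∈ T := by
    intro a ha
    by_contra hcon
    simp [hVdef, hcon] at ha
  have hVsum : ∀ F : A → ℝ, ∑ a, V a * F a =
      (∑ a ∈ T, Real.exp (Real.log (Q a) + l * r a) * F a) / g l := by
    intro F
    simp only [hVdef, ite_mul, zero_mul, Finset.sum_ite_mem, Finset.univ_inter, Finset.sum_div]
    exact Finset.sum_congr rfl fun a _ => by ring
  have hVlog : ∀ a ∈ T, Real.log (V a) = Real.log (Q a) + l * r a - Real.log (g l) := by
    intro a ha
    simp only [hVdef, ha, if_true]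
    rw [Real.log_div (Real.exp_pos _).ne' hgpos.ne', Real.log_exp]
  have hval : ∀ c : ℝ, ∀ F : A → ℝ, (∀ a ∈ T, F a = c * r a - Real.log (g l)) →
      ∑ a, V a * F a = c * (g' / g l) - Real.log (g l) := by
    intro c F hF
    rw [hVsum, Finset.sum_congr rfl fun a ha => by rw [hF a ha]]
    have : ∑ a ∈ T, Real.exp (Real.log (Q a) + l * r a) * (c * r a - Real.log (g l)) =
        c * g' - g l * Real.log (g l) := by
      simp only [hg', hg, Finset.mul_sum, Finset.sum_mul, ← Finset.sum_sub_distrib]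
      exact Finset.sum_congr rfl fun a _ => by ring
    rw [this]
    field_simp
  refine ⟨V, fun a => ?_, ?_, fun a ha => hTP a (hVT a ha), fun a ha => hTQ a (hVT a ha), ?_, ?_⟩
  · simp only [hVdef]
    split_ifs <;> positivity
  · have := hVsum fun _ => 1
    simp only [mul_one] at this
    rw [this]
    exact div_self hgpos.ne'
  · rw [hval (l - 1) _ fun a ha => by rw [hVlog a ha]; simp only [hr]; ring]
    have : (l - 1) * (g' / g l) ≤ 0 := by
      rw [← mul_div_assoc]
      exact div_nonpos_of_nonpos_of_nonneg (by linarith) hgpos.le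
    linarith
  · rw [hval l _ fun a ha => by rw [hVlog a ha]; ring]
    have : l * (g' / g l) ≤ 0 := by
      rw [← mul_div_assoc]
      exact div_nonpos_of_nonpos_of_nonneg (by linarith) hgpos.le
    linarith

/-- The converse half of Chernoff's theorem on binary hypothesis testing. -/
theorem chernoff_overlap {P Q : A → ℝ} (hP : ∀ a, 0 ≤ P a) (hQ : ∀ a, 0 ≤ Q a) {C : ℝ}
    (hC : ∀ l ∈ Set.Ioo (0 : ℝ) 1, Real.exp (-C) ≤ ∑ a, P a ^ l * Q a ^ (1 - l))
    {δ : ℝ} (hδ : 0 < δ) :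
    ∃ N : ℕ, ∀ n : ℕ, N ≤ n →
      Real.exp (-(n * (C + δ))) / 2 ≤ ∑ o : Fin n → A, min (∏ i, P (o i)) (∏ i, Q (o i)) := by
  obtain ⟨V, hV, hV1, hVP, hVQ, h1, h2⟩ := exists_tilted hP hQ hC
  exact overlap_of_witness hP hQ hV hV1 hVP hVQ h1 h2 hδ

end Chernoff

/-! ### Feinstein's maximal code lemma. -/

section Feinstein

variable {A B : Type*} [Fintype A] [Fintype B]

/-- The greedy construction in Feinstein's lemma. -/
theorem feinstein_greedy {p : A → ℝ} (hp : ∀ a, 0 ≤ p a) (hp1 : ∑ a, p a = 1) {V : A → B → ℝ}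
    (hV : ∀ a b, 0 ≤ V a b) (hV1 : ∀ a, ∑ b, V a b = 1) (T : A → Finset B) {θ : ℝ} (hθ : 0 < θ)
    (hT : ∀ a, ∀ b ∈ T a, θ * ∑ a', p a' * V a' b ≤ V a b) (M k : ℕ) (hk : k ≤ M) :
    ∃ (x : ℕ → A) (D : ℕ → Finset B), (∀ i < k, ∀ j < i, Disjoint (D j) (D i)) ∧
      ∀ i < k, D i ⊆ T (x i) ∧
        ∑ a, p a * ∑ b ∈ T a, V a b - M / θ ≤ ∑ b ∈ D i, V (x i) b := by
  classical
  have hA : Nonempty A := by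
    by_contra h
    rw [not_nonempty_iff] at h
    simp at hp1
  induction k with
  | zero => exact ⟨fun _ => hA.some, fun _ => ∅, by simp, by simp⟩
  | succ k ih =>
    obtain ⟨x, D, hD, hx⟩ := ih (Nat.le_of_succ_le hk)
    set U : Finset B := (Finset.range k).biUnion D with hU
    set q : B → ℝ := fun b => ∑ a', p a' * V a' b with hq
    -- On `T a` the output law `q` is at most `V a / θ`, so each earlier decoding set has `q`-mass
    -- at most `1 / θ`. Deleting `U` costs at most `M / θ` on average over inputs, and some input
    -- does at least as well as the average.
    have hqU : ∑ b ∈ U, q b ≤ M / θ := by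
      calc ∑ b ∈ U, q b ≤ ∑ i ∈ Finset.range k, ∑ b ∈ D i, q b :=
            (Finset.sum_biUnion fun i hi j hj hij => by
              rw [Finset.mem_coe, Finset.mem_range] at hi hj
              rcases lt_or_gt_of_ne hij with h | h
              · exact hD j hj i h
              · exact (hD i hi j h).symm).le
        _ ≤ ∑ i ∈ Finset.range k, 1 / θ := by
            refine Finset.sum_le_sum fun i hi => ?_
            have hi := Finset.mem_range.1 hi
            rw [le_div_iff₀ hθ, mul_comm, Finset.mul_sum]
            calc ∑ b ∈ D i, θ * q b ≤ ∑ b ∈ D i, V (x i) b :=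
                  Finset.sum_le_sum fun b hb => hT _ _ ((hx i hi).1 hb)
              _ ≤ ∑ b, V (x i) b := Finset.sum_le_sum_of_subset_of_nonneg (Finset.subset_univ _)
                  fun b _ _ => hV _ _
              _ = 1 := hV1 _
        _ ≤ M / θ := by
            rw [Finset.sum_const, Finset.card_range, nsmul_eq_mul, mul_one_div]
            have : (k : ℝ) ≤ M := by exact_mod_cast Nat.le_of_succ_le hk
            gcongr
    have havg : ∑ a, p a * ∑ b ∈ T a, V a b - M / θ ≤ ∑ a, p a * ∑ b ∈ T a \ U, V a b := by
      have h1 : ∑ a, p a * ∑ b ∈ U, V a b = ∑ b ∈ U, q b := by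
        simp only [Finset.mul_sum, hq]
        exact Finset.sum_comm
      have h2 : ∀ a, ∑ b ∈ T a, V a b ≤ ∑ b ∈ T a \ U, V a b + ∑ b ∈ U, V a b := by
        intro a
        rw [← Finset.sum_inter_add_sum_sdiff (T a) U, add_comm]
        exact add_le_add le_rfl (Finset.sum_le_sum_of_subset_of_nonneg
          (Finset.inter_subset_right (s₁ := T a)) fun b _ _ => hV _ _)
      have h3 : ∑ a, p a * ∑ b ∈ T a, V a b ≤
          ∑ a, p a * ∑ b ∈ T a \ U, V a b + ∑ a, p a * ∑ b ∈ U, V a b := by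
        rw [← Finset.sum_add_distrib]
        refine Finset.sum_le_sum fun a _ => ?_
        rw [← mul_add]
        exact mul_le_mul_of_nonneg_left (h2 a) (hp a)
      linarith
    obtain ⟨a, ha⟩ : ∃ a, ∑ a, p a * ∑ b ∈ T a, V a b - M / θ ≤ ∑ b ∈ T a \ U, V a b := by
      by_contra hcon
      push Not at hcon
      set c := ∑ a, p a * ∑ b ∈ T a, V a b - M / θ with hc
      obtain ⟨a₁, ha₁⟩ : ∃ a, 0 < p a := by
        by_contra hcon'
        push Not at hcon'
        have := Finset.sum_nonpos fun a (_ : a ∈ Finset.univ) => hcon' a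
        linarith
      have : ∑ a, p a * ∑ b ∈ T a \ U, V a b < ∑ a, p a * c :=
        Finset.sum_lt_sum (fun a _ => mul_le_mul_of_nonneg_left (hcon a).le (hp a))
          ⟨a₁, Finset.mem_univ _, mul_lt_mul_of_pos_left (hcon a₁) ha₁⟩
      rw [← Finset.sum_mul, hp1, one_mul] at this
      linarith
    refine ⟨Function.update x k a, Function.update D k (T a \ U), ?_, ?_⟩
    · intro i hi j hj
      have hjk : j ≠ k := by omega
      rw [Function.update_of_ne hjk]
      rcases eq_or_ne i k with rfl | hik
      · rw [Function.update_self]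
        refine Disjoint.mono_left ?_ Finset.disjoint_sdiff
        exact Finset.subset_biUnion_of_mem D (Finset.mem_range.2 hj)
      · rw [Function.update_of_ne hik]
        exact hD i (by omega) j hj
    · intro i hi
      rcases eq_or_ne i k with rfl | hik
      · rw [Function.update_self, Function.update_self]
        exact ⟨Finset.sdiff_subset, ha⟩
      · rw [Function.update_of_ne hik, Function.update_of_ne hik]
        exact hx i (by omega)

/-- Feinstein's lemma, with maximal error probability. -/
theorem feinstein {p : A → ℝ} (hp : ∀ a, 0 ≤ p a) (hp1 : ∑ a, p a = 1) {V : A → B → ℝ}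
    (hV : ∀ a b, 0 ≤ V a b) (hV1 : ∀ a, ∑ b, V a b = 1) (T : A → Finset B) {θ : ℝ} (hθ : 0 < θ)
    (hT : ∀ a, ∀ b ∈ T a, θ * ∑ a', p a' * V a' b ≤ V a b) {M : ℕ} (hM : 0 < M) :
    ∃ (enc : Fin M → A) (dec : B → Fin M), ∀ w,
      ∑ b with dec b ≠ w, V (enc w) b ≤ 1 - ∑ a, p a * ∑ b ∈ T a, V a b + M / θ := by
  classical
  obtain ⟨x, D, hD, hx⟩ := feinstein_greedy hp hp1 hV hV1 T hθ hT M M le_rfl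
  have hdec : ∀ b, ∃ w : Fin M, ∀ w' : Fin M, b ∈ D w' → w = w' := by
    intro b
    by_cases h : ∃ w : Fin M, b ∈ D w
    · obtain ⟨w, hw⟩ := h
      refine ⟨w, fun w' hw' => ?_⟩
      rcases lt_trichotomy w w' with hlt | heq | hlt
      · exact absurd hw' (Finset.disjoint_left.1 (hD w' w'.2 w hlt) hw)
      · exact heq
      · exact absurd hw (Finset.disjoint_left.1 (hD w w.2 w' hlt) hw')
    · push Not at h
      exact ⟨⟨0, hM⟩, fun w' hw' => absurd hw' (h w')⟩
  choose dec hdec using hdec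
  refine ⟨fun w => x w, dec, fun w => ?_⟩
  have h1 := (hx w w.2).2
  have h2 : ∑ b with dec b ≠ w, V (x w) b ≤ ∑ b ∈ (D w)ᶜ, V (x w) b := by
    refine Finset.sum_le_sum_of_subset_of_nonneg (fun b hb => ?_) fun b _ _ => hV _ _
    rw [Finset.mem_compl]
    exact fun hb' => (Finset.mem_filter.1 hb).2 (hdec b w hb')
  have h3 := Finset.sum_add_sum_compl (D w) fun b => V (x w) b
  rw [hV1] at h3
  linarith

end Feinstein

/-! ### Compound channel coding and the weak converse. -/

section Coding

variable {X Y : Type*} [Fintype X] [Fintype Y]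

theorem sum_arrow_prod {n : ℕ} (F : (Fin n → X) → (Fin n → Y) → ℝ) :
    ∑ x, ∑ y, F x y = ∑ o : Fin n → X × Y, F (fun i => (o i).1) (fun i => (o i).2) := by
  rw [← Fintype.sum_prod_type']
  exact (Fintype.sum_equiv (Equiv.arrowProdEquivProdArrow (Fin n) (fun _ => X) fun _ => Y)
    _ _ fun _ => rfl).symm

/-- Mutual information as the expectation of the information density. -/
theorem mutualInfo_eq (P : stdSimplex ℝ X) {U : X → Y → ℝ} :
    mutualInfo P U = ∑ x, P x * ∑ y, U x y *
      (Real.log (U x y) - Real.log (∑ x', P x' * U x' y)) := by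
  simp only [mutualInfo, entropy, Real.negMulLog, mul_sub, Finset.sum_sub_distrib, neg_mul,
    Finset.sum_neg_distrib, mul_neg]
  rw [sub_neg_eq_add, neg_add_eq_sub]
  congr 1
  simp only [Finset.sum_mul, Finset.mul_sum]
  rw [Finset.sum_comm]
  exact Finset.sum_congr rfl fun _ _ => Finset.sum_congr rfl fun _ _ => by ring

/-- Under the joint distribution of input and output, the information density with respect to any
subdistribution of the output is asymptotically at least the mutual information. -/
theorem info_density_lower (P : stdSimplex ℝ X) {U : X → Y → ℝ} (hU : ∀ x y, 0 ≤ U x y)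
    (hU1 : ∀ x, ∑ y, U x y = 1) {δ η : ℝ} (hδ : 0 < δ) (hη : 0 < η) :
    ∃ N : ℕ, ∀ n : ℕ, N ≤ n → ∀ Q : (Fin n → Y) → ℝ, (∀ y, 0 ≤ Q y) → ∑ y, Q y ≤ 1 →
      ∑ x : Fin n → X, (∏ i, P (x i)) *
        ∑ y with ∏ i, U (x i) (y i) < Real.exp (n * (mutualInfo P U - δ)) * Q y,
          ∏ i, U (x i) (y i) ≤ η := by
  classical
  set q : Y → ℝ := fun y => ∑ x', P x' * U x' y with hq
  have hP0 : ∀ x, 0 ≤ P x := fun x => P.2.1 x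
  have hP1 : ∑ x, P x = 1 := P.2.2
  have hp0 : ∀ a : X × Y, 0 ≤ P a.1 * U a.1 a.2 := fun a => mul_nonneg (hP0 _) (hU _ _)
  have hp1 : ∑ a : X × Y, P a.1 * U a.1 a.2 = 1 := by
    rw [Fintype.sum_prod_type]
    simp only [← Finset.mul_sum, hU1, mul_one, hP1]
  have hq0 : ∀ y, 0 ≤ q y := fun y => Finset.sum_nonneg fun x _ => mul_nonneg (hP0 x) (hU x y)
  have hmean : ∑ a : X × Y, P a.1 * U a.1 a.2 * (Real.log (U a.1 a.2) - Real.log (q a.2)) =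
      mutualInfo P U := by
    rw [mutualInfo_eq, Fintype.sum_prod_type]
    simp only [Finset.mul_sum, mul_assoc, hq]
  -- Half of `δ` pays for the law of large numbers relative to the true output law `q`, the other
  -- half for replacing its `n`-fold product by `Q`.
  obtain ⟨N₁, hN₁⟩ := weak_law_lower hp0 hp1
    (fun a : X × Y => Real.log (U a.1 a.2) - Real.log (q a.2)) (half_pos hδ) (half_pos hη)
  obtain ⟨N₂, hN₂⟩ := exists_nat_gt (-Real.log (η / 2) / (δ / 2))
  refine ⟨max N₁ N₂, fun n hn Q hQ0 hQ1 => ?_⟩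
  have h1 := hN₁ n ((le_max_left _ _).trans hn)
  have hexp : Real.exp (-(n * (δ / 2))) ≤ η / 2 := by
    have h2 : (N₂ : ℝ) ≤ n := by exact_mod_cast (le_max_right _ _).trans hn
    have := (div_lt_iff₀ (half_pos hδ)).1 (hN₂.trans_le h2)
    rw [← Real.le_log_iff_exp_le (half_pos hη)]
    linarith
  rw [hmean] at h1
  simp only [Finset.sum_filter] at h1 ⊢
  have hprod : ∀ (x : Fin n → X) (y : Fin n → Y), (∏ i, P (x i)) * ∏ i, U (x i) (y i) =
      ∏ i, P (x i) * U (x i) (y i) := fun x y => Finset.prod_mul_distrib.symm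
  -- Summing out `x` leaves the `q`-product mass of the set where it is at most `exp (-n δ / 2) *
  -- Q`; as `Q` has mass at most 1, this is exponentially small.
  have h2 : ∑ x : Fin n → X, ∑ y : Fin n → Y,
      (if ∏ i, q (y i) ≤ Real.exp (-(n * (δ / 2))) * Q y then
        ∏ i, P (x i) * U (x i) (y i) else 0) ≤ η / 2 := by
    rw [Finset.sum_comm]
    calc _ ≤ ∑ y, Real.exp (-(n * (δ / 2))) * Q y := by
          refine Finset.sum_le_sum fun y _ => ?_
          split_ifs with h
          · refine le_trans (le_of_eq ?_) h
            exact sum_prod_fun fun i x => P x * U x (y i)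
          · simpa using mul_nonneg (Real.exp_pos _).le (hQ0 y)
      _ ≤ Real.exp (-(n * (δ / 2))) * 1 := by
          rw [← Finset.mul_sum]
          exact mul_le_mul_of_nonneg_left hQ1 (Real.exp_pos _).le
      _ ≤ η / 2 := by rwa [mul_one]
  rw [← sum_arrow_prod fun x y => if ∑ i, (Real.log (U (x i) (y i)) - Real.log (q (y i))) ≤
    n * (mutualInfo P U - δ / 2) then ∏ i, P (x i) * U (x i) (y i) else 0] at h1
  refine le_trans ?_ ((add_le_add h1 h2).trans_eq (add_halves η))
  rw [← Finset.sum_add_distrib]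
  refine Finset.sum_le_sum fun x _ => ?_
  rw [Finset.mul_sum, ← Finset.sum_add_distrib]
  refine Finset.sum_le_sum fun y _ => ?_
  rw [mul_ite, mul_zero, hprod]
  have hnn : 0 ≤ ∏ i, P (x i) * U (x i) (y i) :=
    Finset.prod_nonneg fun _ _ => mul_nonneg (hP0 _) (hU _ _)
  by_cases hbad : ∏ i, U (x i) (y i) < Real.exp (n * (mutualInfo P U - δ)) * Q y
  swap
  · rw [if_neg hbad]
    split_ifs <;> linarith
  rw [if_pos hbad]
  by_cases ha : ∑ i, (Real.log (U (x i) (y i)) - Real.log (q (y i))) ≤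
      n * (mutualInfo P U - δ / 2)
  · rw [if_pos ha]
    split_ifs <;> linarith
  rw [if_neg ha, zero_add]
  by_cases hpos : ∀ i, 0 < P (x i) * U (x i) (y i)
  swap
  · push Not at hpos
    obtain ⟨i, hi⟩ := hpos
    rw [Finset.prod_eq_zero (f := fun i => P (x i) * U (x i) (y i)) (Finset.mem_univ i)
      (le_antisymm hi (mul_nonneg (hP0 _) (hU _ _)))]
    simp
  rw [if_pos]
  have hUpos : ∀ i, 0 < U (x i) (y i) := fun i => pos_of_mul_pos_right (hpos i) (hP0 _)
  have hqpos : ∀ i, 0 < q (y i) := fun i => (hpos i).trans_le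
    (Finset.single_le_sum (f := fun x' => P x' * U x' (y i))
      (fun x' _ => mul_nonneg (hP0 x') (hU x' _)) (Finset.mem_univ (x i)))
  have hUe : ∏ i, U (x i) (y i) = Real.exp (∑ i, Real.log (U (x i) (y i))) := by
    rw [Real.exp_sum]; exact Finset.prod_congr rfl fun i _ => (Real.exp_log (hUpos i)).symm
  have hqe : ∏ i, q (y i) = Real.exp (∑ i, Real.log (q (y i))) := by
    rw [Real.exp_sum]; exact Finset.prod_congr rfl fun i _ => (Real.exp_log (hqpos i)).symm
  rw [Finset.sum_sub_distrib, not_le] at ha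
  calc ∏ i, q (y i) ≤ Real.exp (-(n * (mutualInfo P U - δ / 2))) * ∏ i, U (x i) (y i) := by
        rw [hqe, hUe, ← Real.exp_add]
        exact Real.exp_le_exp.2 (by linarith)
    _ ≤ Real.exp (-(n * (mutualInfo P U - δ / 2))) *
        (Real.exp (n * (mutualInfo P U - δ)) * Q y) :=
        mul_le_mul_of_nonneg_left hbad.le (Real.exp_pos _).le
    _ = Real.exp (-(n * (δ / 2))) * Q y := by
        rw [← mul_assoc, ← Real.exp_add]
        congr 2
        ring

/-- Achievability for the compound channel with finitely many states, for the maximal error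
probability. -/
theorem compound_code {S : Type*} [Fintype S] [Nonempty S] (P : stdSimplex ℝ X)
    {U : S → X → Y → ℝ} (hU : ∀ s x y, 0 ≤ U s x y) (hU1 : ∀ s x, ∑ y, U s x y = 1) {I : ℝ}
    (hI : ∀ s, I ≤ mutualInfo P (U s)) {δ ε : ℝ} (hδ : 0 < δ) (hε : 0 < ε) :
    ∃ N : ℕ, ∀ n : ℕ, N ≤ n → ∀ M : ℕ, 0 < M → (M : ℝ) ≤ Real.exp (n * (I - δ)) →
      ∃ (enc : Fin M → Fin n → X) (dec : (Fin n → Y) → Fin M), ∀ s w,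
        ∑ y with dec y ≠ w, ∏ i, U s (enc w i) (y i) ≤ ε := by
  classical
  set K : ℝ := (Fintype.card S : ℝ) with hK
  have hKpos : 0 < K := by rw [hK]; exact_mod_cast Fintype.card_pos
  -- Two errors of size `η` for the mixture become `ε` after the factor `K` lost in passing to a
  -- single state.
  set η : ℝ := ε / (2 * K) with hη
  have hηpos : 0 < η := by positivity
  choose N hN using fun s => info_density_lower P (hU s) (hU1 s) (show 0 < δ / 4 by linarith) hηpos
  obtain ⟨N₁, hN₁⟩ := exists_nat_gt (Real.log K / (δ / 4))
  obtain ⟨N₂, hN₂⟩ := exists_nat_gt (-Real.log η / (δ / 2))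
  refine ⟨max (Finset.univ.sup N) (max N₁ N₂), fun n hn M hM hMle => ?_⟩
  have hNs : ∀ s, N s ≤ n := fun s =>
    (Finset.le_sup (Finset.mem_univ s)).trans ((le_max_left _ _).trans hn)
  have hn1 : (N₁ : ℝ) ≤ n := by
    exact_mod_cast (le_max_left _ _).trans ((le_max_right _ _).trans hn)
  have hn2 : (N₂ : ℝ) ≤ n := by
    exact_mod_cast (le_max_right _ _).trans ((le_max_right _ _).trans hn)
  have hKexp : K ≤ Real.exp (n * (δ / 4)) := by
    rw [← Real.log_le_iff_le_exp hKpos]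
    exact ((div_lt_iff₀ (by linarith)).1 (hN₁.trans_le hn1)).le
  have hexp : Real.exp (-(n * (δ / 2))) ≤ η := by
    have := (div_lt_iff₀ (half_pos hδ)).1 (hN₂.trans_le hn2)
    rw [← Real.le_log_iff_exp_le hηpos]
    linarith
  set p : (Fin n → X) → ℝ := fun x => ∏ i, P (x i) with hp
  set Un : S → (Fin n → X) → (Fin n → Y) → ℝ := fun s x y => ∏ i, U s (x i) (y i) with hUn
  have hp0 : ∀ x, 0 ≤ p x := fun x => Finset.prod_nonneg fun i _ => P.2.1 _
  have hp1 : ∑ x, p x = 1 := sum_prod_eq_one (p := fun _ => P) fun _ => P.2.2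
  have hUn0 : ∀ s x y, 0 ≤ Un s x y := fun s x y => Finset.prod_nonneg fun i _ => hU _ _ _
  have hUn1 : ∀ s x, ∑ y, Un s x y = 1 := fun s x =>
    sum_prod_eq_one (p := fun i => U s (x i)) fun i => hU1 s _
  set V : (Fin n → X) → (Fin n → Y) → ℝ := fun x y => K⁻¹ * ∑ s, Un s x y with hV
  have hV0 : ∀ x y, 0 ≤ V x y := fun x y =>
    mul_nonneg (inv_nonneg.2 hKpos.le) (Finset.sum_nonneg fun s _ => hUn0 s x y)
  have hV1 : ∀ x, ∑ y, V x y = 1 := by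
    intro x
    simp only [hV]
    rw [← Finset.mul_sum, Finset.sum_comm]
    simp only [hUn1, Finset.sum_const, Finset.card_univ, nsmul_eq_mul, mul_one]
    exact inv_mul_cancel₀ hKpos.ne'
  set Q : (Fin n → Y) → ℝ := fun y => ∑ x, p x * V x y with hQ
  have hQ0 : ∀ y, 0 ≤ Q y := fun y => Finset.sum_nonneg fun x _ => mul_nonneg (hp0 x) (hV0 x y)
  have hQ1 : ∑ y, Q y ≤ 1 := by
    simp only [hQ]
    rw [Finset.sum_comm]
    simp only [← Finset.mul_sum, hV1, mul_one, hp1, le_refl]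
  -- The threshold lies `δ / 2` above the rate, making `M / θ` small, and `δ / 2` below `I`: one `δ
  -- / 4` absorbs `K`, the other is the slack in the information density.
  set θ : ℝ := Real.exp (n * (I - δ / 2)) with hθ
  set T : (Fin n → X) → Finset (Fin n → Y) := fun x => Finset.univ.filter fun y =>
    θ * Q y ≤ V x y with hT
  obtain ⟨enc, dec, hcode⟩ := feinstein hp0 hp1 hV0 hV1 T (Real.exp_pos _)
    (fun x y hy => (Finset.mem_filter.1 hy).2) hM
  refine ⟨enc, dec, fun s w => ?_⟩
  have hUV : ∀ s x y, Un s x y ≤ K * V x y := by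
    intro s x y
    simp only [hV]
    rw [mul_inv_cancel_left₀ hKpos.ne']
    exact Finset.single_le_sum (f := fun s => Un s x y) (fun s _ => hUn0 s x y)
      (Finset.mem_univ s)
  have hMθ : M / θ ≤ η := by
    refine le_trans ?_ hexp
    rw [div_le_iff₀ (Real.exp_pos _), ← Real.exp_add]
    refine hMle.trans (Real.exp_le_exp.2 (by linarith))
  have hout : 1 - ∑ x, p x * ∑ y ∈ T x, V x y ≤ η := by
    have h1 : 1 - ∑ x, p x * ∑ y ∈ T x, V x y =
        K⁻¹ * ∑ s, ∑ x, p x * ∑ y ∈ (T x)ᶜ, Un s x y := by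
      have h2 : ∀ x, ∑ y ∈ (T x)ᶜ, V x y = 1 - ∑ y ∈ T x, V x y := by
        intro x
        rw [← hV1 x, ← Finset.sum_add_sum_compl (T x)]
        ring
      have h3 : 1 - ∑ x, p x * ∑ y ∈ T x, V x y = ∑ x, p x * ∑ y ∈ (T x)ᶜ, V x y := by
        simp only [h2, mul_sub, mul_one, Finset.sum_sub_distrib, hp1]
      rw [h3, Finset.sum_comm, Finset.mul_sum]
      refine Finset.sum_congr rfl fun x _ => ?_
      simp only [hV]
      rw [← Finset.mul_sum, Finset.sum_comm, ← Finset.mul_sum]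
      ring
    rw [h1, inv_mul_le_iff₀ hKpos, hK, ← nsmul_eq_mul, ← Finset.card_univ]
    refine Finset.sum_le_card_nsmul _ _ _ fun s _ => ?_
    refine le_trans ?_ (hN s n (hNs s) Q hQ0 hQ1)
    refine Finset.sum_le_sum fun x _ => mul_le_mul_of_nonneg_left ?_ (hp0 x)
    refine Finset.sum_le_sum_of_subset_of_nonneg (fun y hy => ?_) fun y _ _ => hUn0 s x y
    rw [Finset.mem_compl, Finset.mem_filter, not_and, not_le] at hy
    refine Finset.mem_filter.2 ⟨Finset.mem_univ _, ?_⟩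
    calc Un s x y ≤ K * V x y := hUV s x y
      _ < K * (θ * Q y) := mul_lt_mul_of_pos_left (hy (Finset.mem_univ _)) hKpos
      _ ≤ Real.exp (n * (δ / 4)) * (θ * Q y) :=
          mul_le_mul_of_nonneg_right hKexp (mul_nonneg (Real.exp_pos _).le (hQ0 y))
      _ ≤ Real.exp (n * (mutualInfo P (U s) - δ / 4)) * Q y := by
          rw [← mul_assoc, hθ, ← Real.exp_add]
          refine mul_le_mul_of_nonneg_right (Real.exp_le_exp.2 ?_) (hQ0 y)
          have : (n : ℝ) * I ≤ n * mutualInfo P (U s) :=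
            mul_le_mul_of_nonneg_left (hI s) (Nat.cast_nonneg n)
          linarith
  calc ∑ y with dec y ≠ w, Un s (enc w) y ≤ ∑ y with dec y ≠ w, K * V (enc w) y :=
        Finset.sum_le_sum fun y _ => hUV s _ y
    _ = K * ∑ y with dec y ≠ w, V (enc w) y := (Finset.mul_sum _ _ _).symm
    _ ≤ K * (η + η) := mul_le_mul_of_nonneg_left
        ((hcode w).trans (add_le_add hout hMθ)) hKpos.le
    _ = ε := by rw [hη]; field_simp; norm_num

/-- The weak converse of the channel coding theorem: `P` is the average type of the codewords. -/
theorem log_card_le_mutualInfo {n M : ℕ} (hM : 0 < M) (P : stdSimplex ℝ X) {U : X → Y → ℝ}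
    (hU : ∀ x y, 0 ≤ U x y) (hU1 : ∀ x, ∑ y, U x y = 1) {enc : Fin M → Fin n → X}
    {dec : (Fin n → Y) → Fin M} {ε : ℝ} (hPpos : ∀ w i, 0 < P (enc w i))
    (hP : ∀ F : X → ℝ, ∑ w, ∑ i, F (enc w i) = M * (n * ∑ x, P x * F x))
    (herr : ∀ w, ∑ y with dec y ≠ w, ∏ i, U (enc w i) (y i) ≤ ε) :
    (1 - ε) * Real.log M - 1 ≤ n * mutualInfo P U := by
  classical
  set q : Y → ℝ := fun y => ∑ x', P x' * U x' y with hq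
  have hM0 : (0 : ℝ) < M := by exact_mod_cast hM
  have hlog : 0 ≤ Real.log M := Real.log_nonneg (by exact_mod_cast hM)
  have hP0 : ∀ x, 0 ≤ P x := fun x => P.2.1 x
  have hq0 : ∀ y, 0 ≤ q y := fun y => Finset.sum_nonneg fun x _ => mul_nonneg (hP0 x) (hU x y)
  have hq1 : ∑ y, q y = 1 := by
    simp only [hq]
    rw [Finset.sum_comm]
    simp only [← Finset.mul_sum, hU1, mul_one]
    exact P.2.2
  have hqn0 : ∀ y : Fin n → Y, 0 ≤ ∏ i, q (y i) := fun y => Finset.prod_nonneg fun i _ => hq0 _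
  have hqn1 : ∑ y : Fin n → Y, ∏ i, q (y i) = 1 := sum_prod_eq_one (p := fun _ => q) fun _ => hq1
  -- For the average type, the divergences of the letter outputs from `q`, summed over messages and
  -- positions, equal `M * n` times the mutual information exactly; no concavity argument is needed.
  have hmi := hP fun x => ∑ y, U x y * (Real.log (U x y) - Real.log (q y))
  rw [← mutualInfo_eq] at hmi
  have hw : ∀ w, (1 - ε) * Real.log M - M * ∑ y with dec y = w, ∏ i, q (y i) ≤
      ∑ i, ∑ y, U (enc w i) y * (Real.log (U (enc w i) y) - Real.log (q y)) := by
    intro w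
    have hUn1 : ∑ y : Fin n → Y, ∏ i, U (enc w i) (y i) = 1 :=
      sum_prod_eq_one (p := fun i => U (enc w i)) fun i => hU1 _
    rw [← sum_prod_mul_sum (p := fun i => U (enc w i)) (fun i => hU1 _)
      fun i y => Real.log (U (enc w i) y) - Real.log (q y)]
    -- This is `log t ≤ t - 1` at `t = c * v / u`, with `c = M` where decoding is correct and `c =
    -- 1` elsewhere. It replaces Fano's inequality.
    have hpt : ∀ y : Fin n → Y, (if dec y = w then (∏ i, U (enc w i) (y i)) * Real.log M else 0) +
        ∏ i, U (enc w i) (y i) - ((if dec y = w then M * ∏ i, q (y i) else 0) + ∏ i, q (y i)) ≤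
        (∏ i, U (enc w i) (y i)) * ∑ i, (Real.log (U (enc w i) (y i)) - Real.log (q (y i))) := by
      intro y
      by_cases hpos : ∀ i, 0 < U (enc w i) (y i)
      swap
      · push Not at hpos
        obtain ⟨i, hi⟩ := hpos
        rw [Finset.prod_eq_zero (f := fun i => U (enc w i) (y i)) (Finset.mem_univ i)
          (le_antisymm hi (hU _ _))]
        have h1 := hqn0 y
        have h2 := mul_nonneg hM0.le (hqn0 y)
        split_ifs <;> linarith
      have hqpos : ∀ i, 0 < q (y i) := fun i => (mul_pos (hPpos w i) (hpos i)).trans_le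
        (Finset.single_le_sum (f := fun x' => P x' * U x' (y i))
          (fun x' _ => mul_nonneg (hP0 x') (hU x' _)) (Finset.mem_univ (enc w i)))
      have hUp : 0 < ∏ i, U (enc w i) (y i) := Finset.prod_pos fun i _ => hpos i
      have hqp : 0 < ∏ i, q (y i) := Finset.prod_pos fun i _ => hqpos i
      rw [Finset.sum_sub_distrib, ← Real.log_prod fun i _ => (hpos i).ne',
        ← Real.log_prod fun i _ => (hqpos i).ne']
      set u := ∏ i, U (enc w i) (y i)
      set v := ∏ i, q (y i)
      have hgen : ∀ c : ℝ, 0 < c → u * Real.log c + u - c * v ≤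
          u * (Real.log u - Real.log v) := by
        intro c hc
        have h1 := Real.log_le_sub_one_of_pos (show 0 < c * v / u by positivity)
        rw [Real.log_div (by positivity) hUp.ne', Real.log_mul hc.ne' hqp.ne'] at h1
        have h2 := mul_le_mul_of_nonneg_left h1 hUp.le
        have h3 : u * (c * v / u - 1) = c * v - u := by field_simp
        rw [h3] at h2
        linarith
      split_ifs with hd
      · have := hgen M hM0
        linarith
      · have := hgen 1 one_pos
        rw [Real.log_one] at this
        linarith
    refine le_trans ?_ (Finset.sum_le_sum fun y _ => hpt y)
    rw [Finset.sum_sub_distrib, Finset.sum_add_distrib, Finset.sum_add_distrib, hUn1, hqn1,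
      ← Finset.sum_filter, ← Finset.sum_filter, ← Finset.sum_mul, ← Finset.mul_sum]
    have hsplit := Finset.sum_filter_add_sum_filter_not Finset.univ (fun y => dec y = w)
      fun y => ∏ i, U (enc w i) (y i)
    rw [hUn1] at hsplit
    have : (1 - ε) * Real.log M ≤
        (∑ y with dec y = w, ∏ i, U (enc w i) (y i)) * Real.log M :=
      mul_le_mul_of_nonneg_right (by linarith [herr w]) hlog
    linarith
  -- The decoding regions partition the outputs, so the penalties `M * q`-mass total `M`, that is 1
  -- per message.
  have hsum := Finset.sum_le_sum fun w (_ : w ∈ Finset.univ) => hw w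
  rw [hmi, Finset.sum_sub_distrib, Finset.sum_const, Finset.card_univ, Fintype.card_fin,
    nsmul_eq_mul, ← Finset.mul_sum, Finset.sum_fiberwise Finset.univ dec fun y => ∏ i, q (y i),
    hqn1, ← mul_sub] at hsum
  exact le_of_mul_le_mul_left hsum hM0

end Coding

/-! ### Marginals of the channel and error events. -/

section Channel

variable {S X Y Z : Type*} [Fintype Y] [Fintype Z]

theorem chanY_nonneg (W : S → X → stdSimplex ℝ (Y × Z)) (s : S) (x : X) (y : Y) :
    0 ≤ chanY W s x y :=
  Finset.sum_nonneg fun _ _ => (W s x).2.1 _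

theorem chanZ_nonneg (W : S → X → stdSimplex ℝ (Y × Z)) (s : S) (x : X) (z : Z) :
    0 ≤ chanZ W s x z :=
  Finset.sum_nonneg fun _ _ => (W s x).2.1 _

theorem sum_chanY (W : S → X → stdSimplex ℝ (Y × Z)) (s : S) (x : X) :
    ∑ y, chanY W s x y = 1 := by
  simp only [chanY]
  rw [← Fintype.sum_prod_type']
  exact (W s x).2.2

theorem outProb_fst {n : ℕ} (W : S → X → stdSimplex ℝ (Y × Z)) (s : S) (x : Fin n → X)
    (q : (Fin n → Y) → Prop) [DecidablePred q] :
    outProb W s x {o | q fun i => (o i).1} = ∑ y with q y, ∏ i, chanY W s (x i) (y i) := by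
  classical
  simp only [outProb, Set.indicator_apply, Set.mem_ofPred_eq]
  rw [← sum_arrow_prod fun (y : Fin n → Y) (z : Fin n → Z) =>
    if q y then ∏ i, W s (x i) (y i, z i) else 0, Finset.sum_filter]
  refine Finset.sum_congr rfl fun y _ => ?_
  split_ifs
  · exact sum_prod_fun fun i z => W s (x i) (y i, z)
  · exact Finset.sum_const_zero

theorem outProb_snd {n : ℕ} (W : S → X → stdSimplex ℝ (Y × Z)) (s : S) (x : Fin n → X)
    (q : (Fin n → Z) → Prop) [DecidablePred q] :
    outProb W s x {o | q fun i => (o i).2} = ∑ z with q z, ∏ i, chanZ W s (x i) (z i) := by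
  classical
  simp only [outProb, Set.indicator_apply, Set.mem_ofPred_eq]
  rw [← sum_arrow_prod fun (y : Fin n → Y) (z : Fin n → Z) =>
    if q z then ∏ i, W s (x i) (y i, z i) else 0, Finset.sum_filter, Finset.sum_comm]
  refine Finset.sum_congr rfl fun z _ => ?_
  split_ifs
  · exact sum_prod_fun fun i y => W s (x i) (y, z i)
  · exact Finset.sum_const_zero

theorem outProb_le_commError [Finite S] {n : ℕ} (C : OpenLoopCode S X Y Z n)
    (W : S → X → stdSimplex ℝ (Y × Z)) (s : S) (w : Fin C.M) :
    outProb W s (C.enc w) {o | C.dec (fun i => (o i).1) ≠ w} ≤ C.commError W :=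
  le_ciSup (f := fun p : S × Fin C.M =>
    outProb W p.1 (C.enc p.2) {o | C.dec (fun i => (o i).1) ≠ p.2})
    (Set.finite_range _).bddAbove (s, w)

theorem outProb_le_detError [Finite S] {n : ℕ} (C : OpenLoopCode S X Y Z n)
    (W : S → X → stdSimplex ℝ (Y × Z)) (s : S) (w : Fin C.M) :
    outProb W s (C.enc w) {o | C.est (C.enc w) (fun i => (o i).2) ≠ s} ≤ C.detError W :=
  le_ciSup (f := fun p : S × Fin C.M =>
    outProb W p.1 (C.enc p.2) {o | C.est (C.enc p.2) (fun i => (o i).2) ≠ p.1})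
    (Set.finite_range _).bddAbove (s, w)

end Channel

/-! ### Extended-valued logarithms. -/

section NegLog

theorem negLog_of_nonpos {t : ℝ} (ht : t ≤ 0) : negLog t = ⊤ := by
  simp [negLog, ENNReal.ofReal_of_nonpos ht]

theorem negLog_of_pos {t : ℝ} (ht : 0 < t) : negLog t = ((-Real.log t : ℝ) : EReal) := by
  rw [negLog, ENNReal.log_ofReal_of_pos ht, EReal.coe_neg]

theorem coe_le_negLog {a t : ℝ} : (a : EReal) ≤ negLog t ↔ t ≤ Real.exp (-a) := by
  rcases le_or_gt t 0 with ht | ht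
  · simp [negLog_of_nonpos ht, ht.trans (Real.exp_pos _).le]
  · rw [negLog_of_pos ht, EReal.coe_le_coe_iff, ← Real.log_le_iff_le_exp ht, le_neg]

/-- Turns exponent bounds into real inequalities. Positivity of `n` matters: for `n = 0` the factor
`1 / n` is 0 and annihilates the value `⊤`. -/
theorem coe_le_mul_negLog {n : ℕ} (hn : 0 < n) {a t : ℝ} :
    (a : EReal) ≤ ((1 / (n : ℝ) : ℝ) : EReal) * negLog t ↔ t ≤ Real.exp (-(n * a)) := by
  have hn' : (0 : ℝ) < n := by exact_mod_cast hn
  rcases le_or_gt t 0 with ht | ht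
  · rw [negLog_of_nonpos ht, EReal.coe_mul_top_of_pos (by positivity)]
    simp [ht.trans (Real.exp_pos _).le]
  · rw [negLog_of_pos ht, ← EReal.coe_mul, EReal.coe_le_coe_iff, ← Real.log_le_iff_le_exp ht,
      one_div, ← div_eq_inv_mul, le_div_iff₀ hn', le_neg, mul_comm]

/-- Distributivity in `EReal` holds here because the weights are nonnegative; `c` may be infinite.
-/
theorem sum_coe_mul {X : Type*} [Fintype X] (P : stdSimplex ℝ X) (c : EReal) :
    ∑ x, (P x : EReal) * c = c := by
  classical
  have h : ∀ t : Finset X, ∑ x ∈ t, (P x : EReal) * c = ((∑ x ∈ t, P x : ℝ) : EReal) * c := by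
    intro t
    induction t using Finset.induction_on with
    | empty => simp
    | insert a t ha ih =>
      rw [Finset.sum_insert ha, Finset.sum_insert ha, ih, EReal.coe_add,
        EReal.right_distrib_of_nonneg]
      · exact EReal.coe_nonneg.2 (P.2.1 a)
      · exact EReal.coe_nonneg.2 (Finset.sum_nonneg fun x _ => P.2.1 x)
  rw [h, show ∑ x, P x = 1 from P.2.2, EReal.coe_one, one_mul]

end NegLog

/-! ### State detection under the symmetry hypothesis. -/

section Detection

variable {S X Y Z : Type*} [Fintype Y] [Fintype Z]

/-- All the rows of the sensing channel are permutations of the row of `x₀`, by a permutation that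
does not depend on the state. -/
def SensingSymmetric (W : S → X → stdSimplex ℝ (Y × Z)) (x₀ : X) : Prop :=
  ∀ x : X, ∃ π : Equiv.Perm Z, ∀ (s : S) (z : Z), chanZ W s x z = chanZ W s x₀ (π z)

variable {W : S → X → stdSimplex ℝ (Y × Z)} {x₀ : X}

theorem SensingSymmetric.chernoffCoeff_eq (h : SensingSymmetric W x₀) (s s' : S) (x : X) (l : ℝ) :
    ∑ z, chanZ W s x z ^ l * chanZ W s' x z ^ (1 - l) =
      ∑ z, chanZ W s x₀ z ^ l * chanZ W s' x₀ z ^ (1 - l) := by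
  obtain ⟨π, hπ⟩ := h x
  simp only [hπ]
  exact Equiv.sum_comp π fun z => chanZ W s x₀ z ^ l * chanZ W s' x₀ z ^ (1 - l)

theorem SensingSymmetric.phi_eq [Fintype X] (h : SensingSymmetric W x₀) (P : stdSimplex ℝ X) :
    phi W P = ⨅ (s : S) (s' : S) (_ : s' ≠ s), ⨆ l ∈ Set.Icc (0 : ℝ) 1,
      negLog (∑ z, chanZ W s x₀ z ^ l * chanZ W s' x₀ z ^ (1 - l)) := by
  simp only [phi, h.chernoffCoeff_eq, sum_coe_mul]

/-- Relabelling each output coordinate by the permutation of its input letter acts on both laws at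
once, so the overlap does not see the codeword. -/
theorem SensingSymmetric.sum_min_eq (h : SensingSymmetric W x₀) (s s' : S) {n : ℕ}
    (x : Fin n → X) :
    ∑ z : Fin n → Z, min (∏ i, chanZ W s (x i) (z i)) (∏ i, chanZ W s' (x i) (z i)) =
      ∑ z : Fin n → Z, min (∏ i, chanZ W s x₀ (z i)) (∏ i, chanZ W s' x₀ (z i)) := by
  choose π hπ using h
  refine Fintype.sum_equiv (Equiv.piCongrRight fun i => π (x i)) _ _ fun z => ?_
  simp only [hπ (x _), Equiv.piCongrRight_apply, Pi.map_apply]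

/-- The Chernoff bound for the maximum likelihood estimator of the state. -/
theorem SensingSymmetric.exists_estimator [Fintype S] [Nonempty S] (h : SensingSymmetric W x₀)
    {r : ℝ} (hr : 0 ≤ r)
    (hl : ∀ s s', s' ≠ s → ∃ l ∈ Set.Icc (0 : ℝ) 1,
      ∑ z, chanZ W s x₀ z ^ l * chanZ W s' x₀ z ^ (1 - l) ≤ r) (n : ℕ) :
    ∃ est : (Fin n → X) → (Fin n → Z) → S, ∀ s x,
      outProb W s x {o | est x (fun i => (o i).2) ≠ s} ≤ Fintype.card S * r ^ n := by
  classical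
  have hmax : ∀ (x : Fin n → X) (z : Fin n → Z), ∃ s, ∀ s',
      ∏ i, chanZ W s' (x i) (z i) ≤ ∏ i, chanZ W s (x i) (z i) := fun x z =>
    Finite.exists_max fun s => ∏ i, chanZ W s (x i) (z i)
  choose est hest using hmax
  refine ⟨est, fun s x => ?_⟩
  have hnn : ∀ s (z : Fin n → Z), 0 ≤ ∏ i, chanZ W s (x i) (z i) := fun s z =>
    Finset.prod_nonneg fun i _ => chanZ_nonneg W s _ _
  rw [outProb_snd W s x fun z => est x z ≠ s, Finset.sum_filter]
  -- Union bound over the wrong estimate `s'`, which lets the exponent `l` depend on the pair of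
  -- states.
  have hpt : ∀ z : Fin n → Z, (if est x z ≠ s then ∏ i, chanZ W s (x i) (z i) else 0) =
      ∑ s', if est x z = s' ∧ s' ≠ s then ∏ i, chanZ W s (x i) (z i) else 0 := by
    intro z
    simp only [ite_and, Finset.sum_ite_eq, Finset.mem_univ, if_true]
  simp only [hpt]
  rw [Finset.sum_comm, ← nsmul_eq_mul, ← Finset.card_univ]
  refine Finset.sum_le_card_nsmul _ _ _ fun s' _ => ?_
  by_cases hs : s' = s
  · simpa [hs] using pow_nonneg hr n
  obtain ⟨l, hl01, hlr⟩ := hl s s' hs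
  calc ∑ z : Fin n → Z, (if est x z = s' ∧ s' ≠ s then ∏ i, chanZ W s (x i) (z i) else 0)
      ≤ ∑ z : Fin n → Z, ∏ i, chanZ W s (x i) (z i) ^ l * chanZ W s' (x i) (z i) ^ (1 - l) := by
        refine Finset.sum_le_sum fun z _ => ?_
        have hrhs : 0 ≤ ∏ i, chanZ W s (x i) (z i) ^ l * chanZ W s' (x i) (z i) ^ (1 - l) :=
          Finset.prod_nonneg fun i _ => mul_nonneg (Real.rpow_nonneg (chanZ_nonneg _ _ _ _) _)
            (Real.rpow_nonneg (chanZ_nonneg _ _ _ _) _)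
        split_ifs with hz
        swap
        · exact hrhs
        have hle := hest x z s
        rw [hz.1] at hle
        -- Splitting the likelihood as `u ^ l * u ^ (1 - l)` uses `u > 0`; the second factor is then
        -- enlarged, since `s'` is at least as likely.
        rcases (hnn s z).eq_or_lt with h0 | h0
        · rw [← h0]; exact hrhs
        rw [Finset.prod_mul_distrib,
          Real.finsetProd_rpow _ _ fun i _ => chanZ_nonneg _ _ _ _,
          Real.finsetProd_rpow _ _ fun i _ => chanZ_nonneg _ _ _ _]
        calc ∏ i, chanZ W s (x i) (z i) =
              (∏ i, chanZ W s (x i) (z i)) ^ l * (∏ i, chanZ W s (x i) (z i)) ^ (1 - l) := by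
              rw [← Real.rpow_add h0, add_sub_cancel, Real.rpow_one]
          _ ≤ _ := mul_le_mul_of_nonneg_left
              (Real.rpow_le_rpow h0.le hle (sub_nonneg.2 hl01.2)) (Real.rpow_nonneg h0.le _)
    _ = ∏ _i : Fin n, ∑ z, chanZ W s x₀ z ^ l * chanZ W s' x₀ z ^ (1 - l) := by
        rw [sum_prod_fun fun i z => chanZ W s (x i) z ^ l * chanZ W s' (x i) z ^ (1 - l)]
        exact Finset.prod_congr rfl fun i _ => h.chernoffCoeff_eq s s' (x i) l
    _ ≤ r ^ n := by
        rw [Finset.prod_const, Finset.card_univ, Fintype.card_fin]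
        exact pow_le_pow_left₀ (Finset.sum_nonneg fun z _ =>
          mul_nonneg (Real.rpow_nonneg (chanZ_nonneg _ _ _ _) _)
            (Real.rpow_nonneg (chanZ_nonneg _ _ _ _) _)) hlr n

/-- No estimator of the state beats the overlap of the laws of the observations under two states. -/
theorem SensingSymmetric.sum_min_le_detError [Finite S] (h : SensingSymmetric W x₀) {s s' : S}
    (hs : s' ≠ s) {n : ℕ} (C : OpenLoopCode S X Y Z n) :
    ∑ z : Fin n → Z, min (∏ i, chanZ W s x₀ (z i)) (∏ i, chanZ W s' x₀ (z i)) ≤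
      2 * C.detError W := by
  classical
  set w : Fin C.M := ⟨0, C.M_pos⟩
  have h1 := outProb_le_detError C W s w
  have h2 := outProb_le_detError C W s' w
  rw [outProb_snd W s (C.enc w) fun z => C.est (C.enc w) z ≠ s, Finset.sum_filter] at h1
  rw [outProb_snd W s' (C.enc w) fun z => C.est (C.enc w) z ≠ s', Finset.sum_filter] at h2
  rw [← h.sum_min_eq s s' (C.enc w), two_mul]
  refine le_trans ?_ (add_le_add h1 h2)
  rw [← Finset.sum_add_distrib]
  refine Finset.sum_le_sum fun z _ => ?_
  have hnn : ∀ s, 0 ≤ ∏ i, chanZ W s (C.enc w i) (z i) := fun s =>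
    Finset.prod_nonneg fun i _ => chanZ_nonneg W s _ _
  -- The estimate is wrong for at least one of the two states, so at least one of the two
  -- likelihoods is counted as error.
  by_cases hz : C.est (C.enc w) z = s
  · rw [if_neg (not_not.2 hz), if_pos (hz.trans_ne hs.symm), zero_add]
    exact min_le_right _ _
  · rw [if_pos hz]
    refine (min_le_left _ _).trans (le_add_of_nonneg_right ?_)
    split_ifs
    exacts [hnn _, le_rfl]

end Detection

/-! ### Converse and achievability for the region. -/

section Region

variable {S X Y Z : Type*} [Fintype S] [Fintype X] [Fintype Y] [Fintype Z]
  {W : S → X → stdSimplex ℝ (Y × Z)} {x₀ : X}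

theorem continuous_mutualInfo {X Y : Type*} [Fintype X] [Fintype Y] (U : X → Y → ℝ) :
    Continuous fun P : stdSimplex ℝ X => mutualInfo P U := by
  have hc : ∀ x, Continuous fun P : stdSimplex ℝ X => P x := fun x =>
    (continuous_apply x).comp continuous_subtype_val
  refine Continuous.sub ?_ ?_
  · refine continuous_finsetSum _ fun y _ => Real.continuous_negMulLog.comp ?_
    exact continuous_finsetSum _ fun x _ => (hc x).mul continuous_const
  · exact continuous_finsetSum _ fun x _ => (hc x).mul continuous_const

theorem exists_isGreatest_compoundInfo [Nonempty S] [Nonempty X] (W : S → X → stdSimplex ℝ (Y × Z)) :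
    ∃ P : stdSimplex ℝ X,
      IsGreatest (Set.range fun P : stdSimplex ℝ X => compoundInfo W P) (compoundInfo W P) := by
  have hcont : Continuous fun P : stdSimplex ℝ X => compoundInfo W P :=
    Continuous.finset_inf'_apply _ fun s _ => continuous_mutualInfo _
  have hne : Nonempty (stdSimplex ℝ X) := by
    classical exact ⟨⟨_, single_mem_stdSimplex ℝ (Classical.arbitrary X)⟩⟩
  have : CompactSpace (stdSimplex ℝ X) := isCompact_iff_compactSpace.1 (isCompact_stdSimplex ℝ X)
  obtain ⟨P, -, hP⟩ := isCompact_univ.exists_isMaxOn Set.univ_nonempty hcont.continuousOn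
  refine ⟨P, ⟨P, rfl⟩, ?_⟩
  rintro _ ⟨Q, rfl⟩
  exact hP (Set.mem_univ Q)

/-- The average type of the codewords of a code, by its expectations. -/
theorem exists_average_type {n M : ℕ} (hn : 0 < n) (hM : 0 < M) (enc : Fin M → Fin n → X) :
    ∃ P : stdSimplex ℝ X, (∀ w i, 0 < P (enc w i)) ∧
      ∀ F : X → ℝ, ∑ w, ∑ i, F (enc w i) = M * (n * ∑ x, P x * F x) := by
  classical
  have hn' : (0 : ℝ) < n := by exact_mod_cast hn
  have hM' : (0 : ℝ) < M := by exact_mod_cast hM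
  set p : X → ℝ := fun x => (M * n : ℝ)⁻¹ * ∑ w, ∑ i, if enc w i = x then 1 else 0 with hp
  have hF : ∀ F : X → ℝ, ∑ w, ∑ i, F (enc w i) = M * (n * ∑ x, p x * F x) := by
    intro F
    have h1 : ∀ x, p x * F x =
        (M * n : ℝ)⁻¹ * ∑ w, ∑ i, if enc w i = x then F x else 0 := by
      intro x
      simp only [hp, mul_assoc, Finset.sum_mul, ite_mul, one_mul, zero_mul]
    simp only [h1]
    rw [← Finset.mul_sum, ← mul_assoc, mul_inv_cancel_left₀ (mul_pos hM' hn').ne']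
    symm
    rw [Finset.sum_comm]
    refine Finset.sum_congr rfl fun w _ => ?_
    rw [Finset.sum_comm]
    simp
  have hnn : ∀ x, 0 ≤ ∑ w, ∑ i, if enc w i = x then (1 : ℝ) else 0 := fun x =>
    Finset.sum_nonneg fun w _ => Finset.sum_nonneg fun i _ => by split_ifs <;> norm_num
  refine ⟨⟨p, fun x => mul_nonneg (by positivity) (hnn x), ?_⟩, fun w i => ?_, hF⟩
  · have := hF fun _ => 1
    simp only [mul_one, Finset.sum_const, Finset.card_univ, Fintype.card_fin, nsmul_eq_mul] at this
    have h2 : (M * n : ℝ) * 1 = M * n * ∑ x, p x := by linarith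
    exact (mul_left_cancel₀ (mul_pos hM' hn').ne' h2).symm
  · refine mul_pos (by positivity) ?_
    have h1 : (1 : ℝ) ≤ ∑ i', if enc w i' = enc w i then (1 : ℝ) else 0 := by
      have := Finset.single_le_sum (f := fun i' => if enc w i' = enc w i then (1 : ℝ) else 0)
        (fun i' _ => by split_ifs <;> norm_num) (Finset.mem_univ i)
      simpa using this
    have h2 := Finset.single_le_sum
      (f := fun w' => ∑ i', if enc w' i' = enc w i then (1 : ℝ) else 0)
      (fun w' _ => Finset.sum_nonneg fun i' _ => by split_ifs <;> norm_num) (Finset.mem_univ w)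
    exact zero_lt_one.trans_le (h1.trans h2)

theorem rate_le_of_achievable [Nonempty S] {R E Rmax : ℝ} (h : Achievable W R E)
    (hmax : ∀ P : stdSimplex ℝ X, compoundInfo W P ≤ Rmax) (hR : 0 ≤ R) : R ≤ Rmax := by
  classical
  by_contra hcon
  rw [not_le] at hcon
  -- The converse will give `(1 - ε) * (R - ε) < Rmax + ε`, hence `R - Rmax < ε * (R + 2)`; this `ε`
  -- makes the right side at most half of the left. Taking `n > 1 / ε` absorbs the additive 1.
  set ε := min (1 / 2) ((R - Rmax) / (2 * (R + 2))) with hε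
  have hεpos : 0 < ε := lt_min (by norm_num) (div_pos (by linarith) (by linarith))
  have hε1 : ε ≤ 1 / 2 := min_le_left _ _
  have hε2 : ε * (2 * (R + 2)) ≤ R - Rmax :=
    (le_div_iff₀ (by linarith)).1 (min_le_right _ _)
  obtain ⟨N, hN⟩ := exists_nat_gt (1 / ε)
  obtain ⟨n, hn, C, hcomm, -, hrate⟩ := h ε hεpos N
  have hn0 : 0 < n := (Nat.zero_le N).trans_lt hn
  have hn' : (0 : ℝ) < n := by exact_mod_cast hn0
  obtain ⟨P, hPpos, hP⟩ := exists_average_type hn0 C.M_pos C.enc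
  have hkey : ∀ s, (1 - ε) * Real.log C.M - 1 ≤ n * mutualInfo P (chanY W s) := fun s =>
    log_card_le_mutualInfo C.M_pos P (chanY_nonneg W s) (sum_chanY W s) hPpos hP fun w => by
      rw [← outProb_fst W s (C.enc w) fun y => C.dec y ≠ w]
      exact (outProb_le_commError C W s w).trans hcomm
  -- The average type is fixed by the code alone, so the state can be chosen afterwards as the worst
  -- one for it.
  obtain ⟨s, -, hs⟩ := Finset.exists_mem_eq_inf' Finset.univ_nonempty
    fun s => mutualInfo P (chanY W s)
  have h1 := hkey s
  have h2 : mutualInfo P (chanY W s) ≤ Rmax := hs ▸ hmax P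
  have h3 : n * (R - ε) ≤ Real.log C.M := by
    rw [OpenLoopCode.rate, one_div, ← div_eq_inv_mul, le_div_iff₀ hn'] at hrate
    linarith
  have h4 : (1 - ε) * (n * (R - ε)) ≤ (1 - ε) * Real.log C.M :=
    mul_le_mul_of_nonneg_left h3 (by linarith)
  have h5 : (n : ℝ) * mutualInfo P (chanY W s) ≤ n * Rmax :=
    mul_le_mul_of_nonneg_left h2 hn'.le
  have h6 : 1 < n * ε := by
    have : (N : ℝ) ≤ n := by exact_mod_cast hn.le
    exact (div_lt_iff₀ hεpos).1 (hN.trans_le this)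
  have h7 : (n : ℝ) * ((1 - ε) * (R - ε)) < n * (Rmax + ε) := by linarith
  have h8 := lt_of_mul_lt_mul_left h7 hn'.le
  nlinarith

theorem SensingSymmetric.exponent_le_of_achievable (h : SensingSymmetric W x₀) {R E : ℝ}
    (hach : Achievable W R E) (P : stdSimplex ℝ X) : (E : EReal) ≤ phi W P := by
  by_contra hcon
  rw [not_le, h.phi_eq] at hcon
  simp only [iInf_lt_iff] at hcon
  obtain ⟨s, s', hs, hlt⟩ := hcon
  obtain ⟨c, hc1, hc2⟩ := EReal.lt_iff_exists_real_btwn.1 hlt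
  have hcE : c < E := EReal.coe_lt_coe_iff.1 hc2
  have hcoef : ∀ l ∈ Set.Ioo (0 : ℝ) 1,
      Real.exp (-c) ≤ ∑ z, chanZ W s x₀ z ^ l * chanZ W s' x₀ z ^ (1 - l) := by
    intro l hl
    have h1 := (le_iSup₂ (f := fun l (_ : l ∈ Set.Icc (0 : ℝ) 1) =>
      negLog (∑ z, chanZ W s x₀ z ^ l * chanZ W s' x₀ z ^ (1 - l))) l
      (Set.Ioo_subset_Icc_self hl)).trans_lt hc1
    rw [← not_le, coe_le_negLog, not_le] at h1
    exact h1.le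
  -- The bounds `exp (-n (c + ε)) / 2` and `2 * exp (-n (E - ε))` differ by `2 * ε` in exponent,
  -- which rules them out once `2 * n * ε > log 4`.
  set ε := (E - c) / 4 with hε
  have hεpos : 0 < ε := by rw [hε]; linarith
  obtain ⟨N₁, hN₁⟩ := chernoff_overlap (chanZ_nonneg W s x₀) (chanZ_nonneg W s' x₀) hcoef hεpos
  obtain ⟨N₂, hN₂⟩ := exists_nat_gt (Real.log 4 / (2 * ε))
  obtain ⟨n, hn, C, -, hdet, -⟩ := hach ε hεpos (max N₁ N₂)
  have hn0 : 0 < n := (Nat.zero_le _).trans_lt hn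
  have h1 := (hN₁ n ((le_max_left _ _).trans hn.le)).trans (h.sum_min_le_detError hs C)
  have h2 := (coe_le_mul_negLog hn0).1 hdet
  have h3 : Real.exp (-(n * (c + ε))) ≤ Real.exp (Real.log 4 + -(n * (E - ε))) := by
    rw [Real.exp_add, Real.exp_log (by norm_num)]
    linarith
  have h4 := Real.exp_le_exp.1 h3
  have h5 : (N₂ : ℝ) ≤ n := by exact_mod_cast (le_max_right _ _).trans hn.le
  have h6 := (div_lt_iff₀ (by linarith)).1 (hN₂.trans_le h5)
  have h7 : E = c + 4 * ε := by rw [hε]; ring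
  rw [h7] at h4
  linarith

/-- Codes for the compound channel with a prescribed rate. -/
theorem exists_code_of_lt [Nonempty S] [Nonempty X] {R : ℝ} {P : stdSimplex ℝ X}
    (W : S → X → stdSimplex ℝ (Y × Z)) (hR : R < compoundInfo W P) (hR0 : 0 ≤ R) {ε : ℝ}
    (hε : 0 < ε) :
    ∃ N : ℕ, ∀ n : ℕ, N ≤ n → ∃ M : ℕ, 0 < M ∧ n * R ≤ Real.log M ∧
      ∃ (enc : Fin M → Fin n → X) (dec : (Fin n → Y) → Fin M), ∀ s w,
        outProb W s (enc w) {o | dec (fun i => (o i).1) ≠ w} ≤ ε := by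
  classical
  set δ := (compoundInfo W P - R) / 2 with hδ
  have hδpos : 0 < δ := by rw [hδ]; linarith
  obtain ⟨N₁, hN₁⟩ := compound_code P (U := chanY W) (chanY_nonneg W) (sum_chanY W)
    (I := compoundInfo W P) (fun s => Finset.inf'_le _ (Finset.mem_univ s)) hδpos hε
  obtain ⟨N₂, hN₂⟩ := exists_nat_gt (Real.log 2 / δ)
  refine ⟨max N₁ N₂, fun n hn => ?_⟩
  have hM : 0 < ⌈Real.exp (n * R)⌉₊ := Nat.ceil_pos.2 (Real.exp_pos _)
  have hn2 : (N₂ : ℝ) ≤ n := by exact_mod_cast (le_max_right _ _).trans hn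
  have hlog2 := (div_lt_iff₀ hδpos).1 (hN₂.trans_le hn2)
  obtain ⟨enc, dec, hcode⟩ := hN₁ n ((le_max_left _ _).trans hn) _ hM (by
    -- As `R ≥ 0`, rounding up at most doubles the number of messages, and `n * δ > log 2` absorbs
    -- the doubling.
    have h1 : (1 : ℝ) ≤ Real.exp (n * R) := Real.one_le_exp (by positivity)
    calc (⌈Real.exp (n * R)⌉₊ : ℝ) ≤ Real.exp (n * R) + 1 :=
          (Nat.ceil_lt_add_one (Real.exp_pos _).le).le
      _ ≤ Real.exp (Real.log 2) * Real.exp (n * R) := by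
          rw [Real.exp_log two_pos]; linarith
      _ ≤ Real.exp (n * (compoundInfo W P - δ)) := by
          rw [← Real.exp_add]
          refine Real.exp_le_exp.2 ?_
          have : compoundInfo W P = R + 2 * δ := by rw [hδ]; ring
          rw [this]
          linarith)
  refine ⟨_, hM, ?_, enc, dec, fun s w => ?_⟩
  · rw [Real.le_log_iff_exp_le (by exact_mod_cast hM)]
    exact Nat.le_ceil _
  · rw [outProb_fst W s (enc w) fun y => dec y ≠ w]
    exact hcode s w

/-- Achievability asks only for rate `R - ε`, which may be negative; a single message then suffices.
-/
theorem exists_code [Nonempty S] [Nonempty X] {R : ℝ} {P : stdSimplex ℝ X}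
    (W : S → X → stdSimplex ℝ (Y × Z)) (hR : R < compoundInfo W P) {ε : ℝ} (hε : 0 < ε) :
    ∃ N : ℕ, ∀ n : ℕ, N ≤ n → ∃ M : ℕ, 0 < M ∧ n * R ≤ Real.log M ∧
      ∃ (enc : Fin M → Fin n → X) (dec : (Fin n → Y) → Fin M), ∀ s w,
        outProb W s (enc w) {o | dec (fun i => (o i).1) ≠ w} ≤ ε := by
  classical
  rcases le_or_gt 0 R with hR0 | hR0
  · exact exists_code_of_lt W hR hR0 hε
  refine ⟨0, fun n _ => ⟨1, one_pos, ?_, fun _ _ => Classical.arbitrary X, fun _ => 0,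
    fun s w => ?_⟩⟩
  · simpa using mul_nonpos_of_nonneg_of_nonpos (Nat.cast_nonneg n) hR0.le
  · rw [outProb_fst W s _ fun _ => (0 : Fin 1) ≠ w]
    simpa [Subsingleton.elim w 0] using hε.le

/-- `P` and `Q` are unrelated: the estimator's guarantee holds for every codeword, so it can be
attached to any code for the compound channel. -/
theorem SensingSymmetric.achievable [Nonempty S] (h : SensingSymmetric W x₀) {R E : ℝ} {P Q : stdSimplex ℝ X}
    (hR : R ≤ compoundInfo W P) (hE : (E : EReal) ≤ phi W Q) : Achievable W R E := by
  intro ε hε N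
  have : Nonempty X := ⟨x₀⟩
  obtain ⟨N₁, hN₁⟩ := exists_code W (show R - ε < compoundInfo W P by linarith) hε
  obtain ⟨N₂, hN₂⟩ := exists_nat_gt (Real.log (Fintype.card S) / (ε / 2))
  set n := max (N + 1) (max N₁ N₂) with hn
  have hNn : N < n := Nat.lt_of_succ_le (le_max_left _ _)
  have hn0 : 0 < n := (Nat.zero_le _).trans_lt hNn
  have hn' : (0 : ℝ) < n := by exact_mod_cast hn0
  obtain ⟨M, hM, hrate, enc, dec, hcode⟩ := hN₁ n ((le_max_left _ _).trans (le_max_right _ _))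
  have hl : ∀ s s', s' ≠ s → ∃ l ∈ Set.Icc (0 : ℝ) 1,
      ∑ z, chanZ W s x₀ z ^ l * chanZ W s' x₀ z ^ (1 - l) ≤ Real.exp (-(E - ε / 2)) := by
    intro s s' hs
    rw [h.phi_eq] at hE
    have h1 := hE.trans ((iInf_le _ s).trans ((iInf_le _ s').trans (iInf_le _ hs)))
    have h2 : ((E - ε / 2 : ℝ) : EReal) < E := EReal.coe_lt_coe_iff.2 (by linarith)
    have h3 := h2.trans_le h1
    simp only [lt_iSup_iff] at h3
    obtain ⟨l, hl01, hlt⟩ := h3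
    exact ⟨l, hl01, coe_le_negLog.1 hlt.le⟩
  -- The remaining `ε / 2` of the exponent absorbs the factor `card S`.
  obtain ⟨est, hest⟩ := h.exists_estimator (Real.exp_pos _).le hl n
  refine ⟨n, hNn, ⟨M, hM, enc, est, dec⟩, ?_, ?_, ?_⟩
  · have : Nonempty (Fin M) := ⟨⟨0, hM⟩⟩
    exact ciSup_le fun p => hcode p.1 p.2
  · refine (coe_le_mul_negLog hn0).2 ?_
    have : Nonempty (Fin M) := ⟨⟨0, hM⟩⟩
    refine ciSup_le fun p => (hest p.1 (enc p.2)).trans ?_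
    have hcard : (0 : ℝ) < Fintype.card S := by exact_mod_cast Fintype.card_pos
    rw [← Real.exp_nat_mul, ← Real.exp_log hcard, ← Real.exp_add]
    refine Real.exp_le_exp.2 ?_
    have h2 : (N₂ : ℝ) ≤ n := by exact_mod_cast (le_max_right _ _).trans (le_max_right _ _)
    have h3 := (div_lt_iff₀ (half_pos hε)).1 (hN₂.trans_le h2)
    linarith
  · rw [OpenLoopCode.rate, one_div, ← div_eq_inv_mul, le_div_iff₀ hn', mul_comm]
    exact hrate

end Region

end JointCommSensing

end

theorem mainTheorem6 {S X Y Z : Type*} [Fintype S] [Nonempty S] [Fintype X] [Fintype Y] [Fintype Z]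
    (W : S → X → stdSimplex ℝ (Y × Z))
    (hsymm : ∃ x₀ : X, ∀ x : X, ∃ π : Equiv.Perm Z, ∀ (s : S) (z : Z),
      JointCommSensing.chanZ W s x z = JointCommSensing.chanZ W s x₀ (π z)) :
    (∀ P Q : stdSimplex ℝ X, JointCommSensing.phi W P = JointCommSensing.phi W Q) ∧
    ∃ (Rmax : ℝ) (Emax : EReal),
      IsGreatest (Set.range fun P : stdSimplex ℝ X => JointCommSensing.compoundInfo W P) Rmax ∧
      IsGreatest (Set.range fun P : stdSimplex ℝ X => JointCommSensing.phi W P) Emax ∧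
      JointCommSensing.openLoopRegion W =
        {p : ℝ × ℝ | 0 ≤ p.1 ∧ 0 ≤ p.2 ∧ p.1 ≤ Rmax ∧ (p.2 : EReal) ≤ Emax} := by
  obtain ⟨x₀, hx₀⟩ := hsymm
  have h : JointCommSensing.SensingSymmetric W x₀ := hx₀
  have : Nonempty X := ⟨x₀⟩
  have hphi : ∀ P Q : stdSimplex ℝ X,
      JointCommSensing.phi W P = JointCommSensing.phi W Q := fun P Q => by
    rw [h.phi_eq, h.phi_eq]
  obtain ⟨P, hP⟩ := JointCommSensing.exists_isGreatest_compoundInfo W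
  refine ⟨hphi, JointCommSensing.compoundInfo W P, JointCommSensing.phi W P, hP,
    ⟨⟨P, rfl⟩, ?_⟩, ?_⟩
  · rintro _ ⟨Q, rfl⟩
    exact (hphi Q P).le
  have hset : {p : ℝ × ℝ | 0 ≤ p.1 ∧ 0 ≤ p.2 ∧ JointCommSensing.Achievable W p.1 p.2} =
      {p : ℝ × ℝ | 0 ≤ p.1 ∧ 0 ≤ p.2 ∧ p.1 ≤ JointCommSensing.compoundInfo W P ∧
        (p.2 : EReal) ≤ JointCommSensing.phi W P} := by
    ext p
    constructor
    · rintro ⟨h1, h2, hach⟩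
      exact ⟨h1, h2, JointCommSensing.rate_le_of_achievable hach (fun Q => hP.2 ⟨Q, rfl⟩) h1,
        h.exponent_le_of_achievable hach P⟩
    · rintro ⟨h1, h2, hR, hE⟩
      exact ⟨h1, h2, h.achievable hR hE⟩
  rw [JointCommSensing.openLoopRegion, hset]
  refine IsClosed.closure_eq ?_
  exact (isClosed_le continuous_const continuous_fst).inter
    ((isClosed_le continuous_const continuous_snd).inter
      ((isClosed_le continuous_fst continuous_const).inter
        (isClosed_le (continuous_coe_real_ereal.comp continuous_snd) continuous_const)))
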